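/- Let $\mathbb X$ be a finite-dimensional real inner product space with norm $\interleave\cdot\interleave$, and consider the problem $$\min_{x\in\mathbb X}\ \Theta(x):=\vartheta(|F(x)|)+\nu\,\psi(T(x))+\lambda\,h(x),\qquad \nu\ge 0,\ \lambda>0, \tag{P}$$ under the following assumptions. * $h:\mathbb X\to(-\infty,\infty]$ is proper, lower semicontinuous, convex, bounded below, and locally Lipschitz relative to its domain $\operatorname{dom}h$. * $F:\mathcal O\to\mathbb R^{m\times n}$ and $T:\mathcal O\to\mathbb R^{p\times q}$ are twice continuously differentiable on an open set $\mathcal O\supset\operatorname{dom}h$ (matrix spaces carry the trace inner product). * $\psi:\mathbb R^{p\times q}\to\mathbb R$ is convex and bounded below. * $\vartheta(z)=\sum_{i,j}\theta(z_{ij})$, where $\theta$ is concave and differentiable on an open interval $I\supset[0,\infty)$ with locally Lipschitz derivative, $\theta'(t)\ge 0$ for all $t\ge 0$, and $\theta(0)=0$. $|z|$ is the entrywise absolute value, and $\nabla\vartheta(z)$ is the matrix with entries $\theta'(z_{ij})$. For $G\in\{F,T\}$ put $\ell_G(x;z)=G(z)+G'(z)(x-z)$. *Algorithm (iPMM).*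 Fix $\varrho>1$, $0<\underline\gamma<\overline\gamma$, $\overline\mu>0$, $\mu_k\in(0,\overline\mu]$ and $x^0\in\operatorname{dom}h$. Given $x^k$, choose $\gamma_{k,0}\in[\underline\gamma,\overline\gamma]$, and for $j=0,1,2,\dots$ choose a self-adjoint linear operator $\mathcal Q_{k,j}$ with $\gamma_{k,j}\mathcal I\preceq\mathcal Q_{k,j}\preceq\varrho\gamma_{k,j}\mathcal I$; let $\overline x^{k,j}$ be the minimizer over $\mathbb X$ of $$\Theta_{k,j}(x)=\langle\nabla\vartheta(|F(x^k)|),|\ell_F(x;x^k)|\rangle+\nu\psi(\ell_T(x;x^k))+\lambda h(x)+\tfrac12\langle x-x^k,\mathcal Q_{k,j}(x-x^k)\rangle+C^k,$$ where $C^k=\vartheta(|F(x^k)|)-\langle\nabla\vartheta(|F(x^k)|),|F(x^k)|\rangle$, and choose $x^{k,j}$ with $$\Theta_{k,j}(x^{k,j})<\Theta(x^k),\qquad \Theta_{k,j}(x^{k,j})-\Theta_{k,j}(\overline x^{k,j})\le\tfrac{\mu_k}{2}\bigl(\Theta(x^k)-\Theta_{k,j}(x^{k,j})\bigr).$$ If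 $\Theta(x^{k,j})\le\Theta_{k,j}(x^{k,j})$, stop the inner loop and set $x^{k+1}=x^{k,j}$; otherwise set $\gamma_{k,j+1}=\varrho\gamma_{k,j}$ and continue with $j+1$. *Subdifferentials and KL functions.* For an extended-real-valued $f$ on a Euclidean space, $\partial f$ is the limiting (Mordukhovich) subdifferential. $f$ is a KL function if for every $\overline w\in\operatorname{dom}\partial f$ there are $\eta\in(0,\infty]$, a neighbourhood $V$ of $\overline w$ and a continuous concave $\varphi:[0,\eta)\to[0,\infty)$, continuously differentiable on $(0,\eta)$, with $\varphi(0)=0$, $\varphi'>0$ on $(0,\eta)$ and $\varphi'(f(w)-f(\overline w))\operatorname{dist}(0,\partial f(w))\ge 1$ for all $w\in V$ with $f(\overline w)<f(w)<f(\overline w)+\eta$ (where $\operatorname{dist}(0,\emptyset)=\infty$). **Theorem (global convergence).** Let $\{x^k\}_{k\in\mathbb N}$ be an infinite sequence generated by the algorithm, and suppose that it is bounded. Let $\widehat\gamma>0$, and suppose that the potential function $$\Xi(x,z,t)=\vartheta(|\ell_F(x;z)|)+\nu\psi(\ell_T(x;z))+\lambda h(x)+\tfrac{\widehat\gamma}{2}\interleave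 x-z\interleave^2+t^2,\qquad (x,z,t)\in\mathbb X\times\mathcal O\times\mathbb R,$$ set to $+\infty$ for $z\notin\mathcal O$, is a KL function. Then $$\sum_{k=1}^\infty\interleave x^{k+1}-x^k\interleave<\infty,$$ and hence $\{x^k\}$ converges to a stationary point $x^*$ of (P), that is, a point $x^*\in\operatorname{dom}h$ with $$0\in F'(x^*)^{*}\bigl[\nabla\vartheta(|F(x^*)|)\circ\partial|F(x^*)|\bigr]+\nu\,T'(x^*)^{*}\,\partial\psi(T(x^*))+\lambda\,\partial h(x^*),$$ where $\circ$ and $\partial|\cdot|$ are taken entrywise. -/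

import Mathlib

open Filter Topology

noncomputable section

namespace IPMM

/-- `ℝ^{m×n}` with the trace inner product and the Frobenius norm; the entry of `y` at `(i, j)`
is `y (i, j)`. -/
abbrev Mat (m n : ℕ) : Type := EuclideanSpace ℝ (Fin m × Fin n)

/-! ### Variational analysis of extended-real-valued functions -/

section Variational

variable {E : Type*} [NormedAddCommGroup E] [InnerProductSpace ℝ E]

/-- Effective domain. -/
def edom (f : E → EReal) : Set E := {x | f x < ⊤}

/-- Regular (Fréchet) subdifferential at a point where `f` is finite. The condition says
`liminf_{y → x, y ≠ x} (f y - f x - ⟨v, y - x⟩) / ‖y - x‖ ≥ 0`. -/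
def regularSubdiff (f : E → EReal) (x : E) : Set E :=
  {v | f x ≠ ⊤ ∧ f x ≠ ⊥ ∧ ∀ ε : ℝ, 0 < ε → ∀ᶠ y in 𝓝 x,
    (((f x).toReal + inner ℝ v (y - x) - ε * ‖y - x‖ : ℝ) : EReal) ≤ f y}

/-- Basic (limiting, Mordukhovich) subdifferential at a point where `f` is finite. -/
def limitingSubdiff (f : E → EReal) (x : E) : Set E :=
  {v | f x ≠ ⊤ ∧ f x ≠ ⊥ ∧ ∃ (u w : ℕ → E),
    Tendsto u atTop (𝓝 x) ∧ Tendsto (fun k => f (u k)) atTop (𝓝 (f x)) ∧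
    (∀ k, w k ∈ regularSubdiff f (u k)) ∧ Tendsto w atTop (𝓝 v)}

/-- The class of desingularizing functions on `[0, η)`, for `η ∈ (0, ∞]`. -/
structure IsDesingularizing (η : EReal) (φ : ℝ → ℝ) : Prop where
  continuousOn : ContinuousOn φ {s : ℝ | 0 ≤ s ∧ (s : EReal) < η}
  concaveOn : ConcaveOn ℝ {s : ℝ | 0 ≤ s ∧ (s : EReal) < η} φ
  nonneg : ∀ s : ℝ, 0 ≤ s → (s : EReal) < η → 0 ≤ φ s
  differentiableAt : ∀ s : ℝ, 0 < s → (s : EReal) < η → DifferentiableAt ℝ φ s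
  continuousOn_deriv : ContinuousOn (deriv φ) {s : ℝ | 0 < s ∧ (s : EReal) < η}
  map_zero : φ 0 = 0
  deriv_pos : ∀ s : ℝ, 0 < s → (s : EReal) < η → 0 < deriv φ s

/-- Kurdyka–Łojasiewicz property of `f` at `xbar`. The distance to the empty set is `∞`. -/
def HasKLPropertyAt (f : E → EReal) (xbar : E) : Prop :=
  ∃ (η : EReal) (φ : ℝ → ℝ), 0 < η ∧ IsDesingularizing η φ ∧
    ∀ᶠ x in 𝓝 xbar, f xbar < f x → f x < f xbar + η →
      1 ≤ ENNReal.ofReal (deriv φ (f x - f xbar).toReal) *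
        Metric.infEDist (0 : E) (limitingSubdiff f x)

/-- `f` is a KL function: it has the KL property at each point of the domain of its limiting
subdifferential. -/
def IsKLFunction (f : E → EReal) : Prop :=
  ∀ x : E, (limitingSubdiff f x).Nonempty → HasKLPropertyAt f x

end Variational

/-! ### The composite model -/

/-- The family of concave functions `θ` on an open interval `I ⊇ [0, ∞)` with a strictly
continuous (locally Lipschitz) derivative, `θ' ≥ 0` on `[0, ∞)` and `θ 0 = 0`. -/
def IsPenalty (θ : ℝ → ℝ) : Prop :=
  (∃ I : Set ℝ, IsOpen I ∧ I.OrdConnected ∧ Set.Ici 0 ⊆ I ∧ ConcaveOn ℝ I θ ∧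
    DifferentiableOn ℝ θ I ∧ LocallyLipschitzOn I (deriv θ)) ∧
  (∀ t : ℝ, 0 ≤ t → 0 ≤ deriv θ t) ∧ θ 0 = 0

/-- Entrywise absolute value. -/
def matAbs {m n : ℕ} (y : Mat m n) : Mat m n := WithLp.toLp 2 (fun i => |y i|)

/-- Entrywise (Hadamard) product. -/
def hadamard {m n : ℕ} (y z : Mat m n) : Mat m n := WithLp.toLp 2 (fun i => y i * z i)

/-- The separable function `ϑ(z) = ∑ θ(z_ij)`. -/
def vtheta {m n : ℕ} (θ : ℝ → ℝ) (z : Mat m n) : ℝ := ∑ i, θ (z i)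

/-- The gradient of `ϑ`, with entries `θ'(z_ij)`. -/
def gradVtheta {m n : ℕ} (θ : ℝ → ℝ) (z : Mat m n) : Mat m n :=
  WithLp.toLp 2 (fun i => deriv θ (z i))

variable {X : Type*} [NormedAddCommGroup X] [InnerProductSpace ℝ X]

/-- The linearization `ℓ_G(x; z) = G(z) + G'(z)(x - z)`. -/
def lin {Y : Type*} [NormedAddCommGroup Y] [NormedSpace ℝ Y] (G : X → Y) (x z : X) : Y :=
  G z + fderiv ℝ G z (x - z)

/-- The data of the problem `min Θ(x) = ϑ(|F(x)|) + ν ψ(T(x)) + lam h(x)`. The maps `F` and `T`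
matter only on the open set `O`, which contains the effective domain of `h`. -/
structure Model (X : Type*) (m n p q : ℕ) where
  O : Set X
  F : X → Mat m n
  T : X → Mat p q
  θ : ℝ → ℝ
  ψ : Mat p q → ℝ
  h : X → EReal
  ν : ℝ
  lam : ℝ

namespace Model

variable {m n p q : ℕ} (M : Model X m n p q)

/-- The standing assumptions on the model, with twice continuously differentiable `F`, `T`. -/
structure Assumptions : Prop where
  nu_nonneg : 0 ≤ M.ν
  lam_pos : 0 < M.lam
  isOpen_O : IsOpen M.O
  edom_subset : edom M.h ⊆ M.O
  contDiffOn_F : ContDiffOn ℝ 2 M.F M.O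
  contDiffOn_T : ContDiffOn ℝ 2 M.T M.O
  penalty : IsPenalty M.θ
  psi_convex : ConvexOn ℝ Set.univ M.ψ
  psi_bddBelow : BddBelow (Set.range M.ψ)
  h_ne_bot : ∀ x, M.h x ≠ ⊥
  h_nonempty : (edom M.h).Nonempty
  h_lsc : LowerSemicontinuous M.h
  h_convex : Convex ℝ {w : X × ℝ | M.h w.1 ≤ (w.2 : EReal)}
  h_lipschitz : LocallyLipschitzOn (edom M.h) (fun x => (M.h x).toReal)
  h_bddBelow : ∃ c : ℝ, ∀ x, (c : EReal) ≤ M.h x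

/-- The objective `Θ`. -/
def Theta (x : X) : EReal :=
  ((vtheta M.θ (matAbs (M.F x)) + M.ν * M.ψ (M.T x) : ℝ) : EReal) + (M.lam : EReal) * M.h x

/-- The objective of the subproblem at the iterate `z` with proximal operator `Q`. Its last real
summand is the constant `C = ϑ(|F(z)|) - ⟨∇ϑ(|F(z)|), |F(z)|⟩`. -/
def ThetaSub (z : X) (Q : X →ₗ[ℝ] X) (x : X) : EReal :=
  ((inner ℝ (gradVtheta M.θ (matAbs (M.F z))) (matAbs (lin M.F x z))
      + M.ν * M.ψ (lin M.T x z)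
      + (1 / 2) * inner ℝ (x - z) (Q (x - z))
      + (vtheta M.θ (matAbs (M.F z))
          - inner ℝ (gradVtheta M.θ (matAbs (M.F z))) (matAbs (M.F z))) : ℝ) : EReal)
    + (M.lam : EReal) * M.h x

open Classical in
/-- The potential function `Ξ(x, z, t)` on the Hilbert product `X × X × ℝ`, where `w = (x, z, t)`.
It is `+∞` where `z ∉ O`, that is, where the linearizations at `z` are not defined. -/
def Xi (c : ℝ) (w : WithLp 2 (X × WithLp 2 (X × ℝ))) : EReal :=
  if w.snd.fst ∈ M.O then
    ((vtheta M.θ (matAbs (lin M.F w.fst w.snd.fst))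
        + M.ν * M.ψ (lin M.T w.fst w.snd.fst)
        + (c / 2) * ‖w.fst - w.snd.fst‖ ^ 2
        + w.snd.snd ^ 2 : ℝ) : EReal)
      + (M.lam : EReal) * M.h w.fst
  else ⊤

/-- Stationary points: `x ∈ dom h` with
`0 ∈ ∇F(x)[∇ϑ(|F(x)|) ∘ ∂|F(x)|] + ν ∇T(x) ∂ψ(T(x)) + lam ∂h(x)`, where `∇F(x)` is the adjoint of
`F'(x)` and `∂|F(x)|` is taken entrywise. -/
def IsStationary [FiniteDimensional ℝ X] (x : X) : Prop :=
  x ∈ edom M.h ∧ ∃ (u : Mat m n) (ζ : Mat p q) (g : X),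
    (∀ i, u i ∈ limitingSubdiff (fun s : ℝ => ((|s| : ℝ) : EReal)) (M.F x i)) ∧
    ζ ∈ limitingSubdiff (fun y : Mat p q => (M.ψ y : EReal)) (M.T x) ∧
    g ∈ limitingSubdiff M.h x ∧
    LinearMap.adjoint (fderiv ℝ M.F x : X →ₗ[ℝ] Mat m n)
        (hadamard (gradVtheta M.θ (matAbs (M.F x))) u)
      + M.ν • LinearMap.adjoint (fderiv ℝ M.T x : X →ₗ[ℝ] Mat p q) ζ
      + M.lam • g = 0

/-- A complete (infinite) run of the inexact proximal majorization-minimization method.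
`x k` is the outer iterate, `γ k j`, `Q k j`, `xin k j`, `xopt k j` are the inner proximal
parameter, proximal operator, inexact minimizer and exact minimizer, and `jlast k` is the index at
which the inner loop stops. Inner data matter only for `j ≤ jlast k`. -/
structure Run where
  rho : ℝ
  γlow : ℝ
  γup : ℝ
  μup : ℝ
  μ : ℕ → ℝ
  x : ℕ → X
  γ : ℕ → ℕ → ℝ
  Q : ℕ → ℕ → X →ₗ[ℝ] X
  xin : ℕ → ℕ → X
  xopt : ℕ → ℕ → X
  jlast : ℕ → ℕ
  one_lt_rho : 1 < rho
  γlow_pos : 0 < γlow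
  γlow_lt : γlow < γup
  μup_pos : 0 < μup
  μ_pos : ∀ k, 0 < μ k
  μ_le : ∀ k, μ k ≤ μup
  x_zero_mem : x 0 ∈ edom M.h
  γ_init : ∀ k, γ k 0 ∈ Set.Icc γlow γup
  γ_succ : ∀ k j, j < jlast k → γ k (j + 1) = rho * γ k j
  Q_symm : ∀ k j, j ≤ jlast k → (Q k j).IsSymmetric
  Q_lower : ∀ k j, j ≤ jlast k → ∀ d, γ k j * ‖d‖ ^ 2 ≤ inner ℝ d (Q k j d)
  Q_upper : ∀ k j, j ≤ jlast k → ∀ d, inner ℝ d (Q k j d) ≤ rho * γ k j * ‖d‖ ^ 2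
  xopt_min : ∀ k j, j ≤ jlast k →
    ∀ y, M.ThetaSub (x k) (Q k j) (xopt k j) ≤ M.ThetaSub (x k) (Q k j) y
  inexact_decrease : ∀ k j, j ≤ jlast k →
    M.ThetaSub (x k) (Q k j) (xin k j) < M.Theta (x k)
  inexact_gap : ∀ k j, j ≤ jlast k →
    M.ThetaSub (x k) (Q k j) (xin k j) - M.ThetaSub (x k) (Q k j) (xopt k j) ≤
      ((μ k / 2 : ℝ) : EReal) * (M.Theta (x k) - M.ThetaSub (x k) (Q k j) (xin k j))
  inner_reject : ∀ k j, j < jlast k →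
    M.ThetaSub (x k) (Q k j) (xin k j) < M.Theta (xin k j)
  inner_accept : ∀ k,
    M.Theta (xin k (jlast k)) ≤ M.ThetaSub (x k) (Q k (jlast k)) (xin k (jlast k))
  x_succ : ∀ k, x (k + 1) = xin k (jlast k)

end Model

end IPMM

end

/-! Let D_k > 0 be the decrease of Θ predicted by the accepted model at x^k. Acceptance gives D_k ≤
Θ(x^k) - Θ(x^{k+1}). Strong convexity of the subproblem and the inexactness test bound both x^{k+1}
- x^k and x̄^k - x^k by O(√D_k), where x̄^k is the exact minimizer. It therefore suffices to show ∑
√D_k < ∞.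

The KL inequality is applied to Ξ at w_k = (x̄^k, x^k, t_k) with t_k = √(E D_k). The optimality
conditions of the subproblem at x̄^k give a subgradient of Ξ at w_k of norm O(√D_k). The term t²
lifts the value: E is chosen so that Θ(x^k) ≤ Ξ(w_k) ≤ Θ(x^k) + O(D_k). By concavity, the slope of
the desingularizing function φ at the larger value Ξ(w_k) is at most its secant slope between
Θ(x^{k+1}) and Θ(x^k). Writing Θ* for the limit of Θ(x^k), near a cluster point D_k ≤ Θ(x^k) -
Θ(x^{k+1}) ≤ O(√D_k) · (φ(Θ(x^k) - Θ*) - φ(Θ(x^{k+1}) - Θ*)). Dividing by √D_k leaves a telescoping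
bound. Monotonicity of Ξ along w_k is never needed. The carriers are
`Run.exists_potential_estimates`, `HasKLPropertyAt.exists_real` and `summable_of_local_decrease`.

Uniform constants come from `Run.exists_compact`: all iterates, trial points and exact minimizers
lie in one compact convex subset of dom h. Taylor bounds there also bound the proximal parameters
(`Run.exists_γ_le`). Passing to the limit in the subproblems yields optimality at a cluster point
x*. This gives stationarity, and it also shows that Ξ has a subgradient at (x*, x*, 0), so that the
KL property is available there. -/

namespace IPMM

/-! ### Tangents and secants of concave functions. -/

section ConcaveReal

variable {S : Set ℝ} {f : ℝ → ℝ} {a b c : ℝ}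

theorem concaveOn_le_tangent (hf : ConcaveOn ℝ S f) (ha : a ∈ S) (hb : b ∈ S)
    (hd : DifferentiableAt ℝ f a) : f b ≤ f a + deriv f a * (b - a) := by
  rcases lt_trichotomy a b with h | h | h
  · have := hf.slope_le_deriv ha hb h hd
    rw [slope_def_field, div_le_iff₀ (by linarith)] at this
    linarith
  · subst h; simp
  · have := hf.deriv_le_slope hb ha h hd
    rw [slope_def_field, le_div_iff₀ (by linarith)] at this
    linarith

/-- Slopes of a concave function decrease to the right. This lets the KL inequality, which holds at
the potential value `c`, be used for the smaller objective values `b < a`. -/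
theorem concaveOn_deriv_mul_sub_le (hf : ConcaveOn ℝ S f) (hb : b ∈ S) (ha : a ∈ S) (hc : c ∈ S)
    (hba : b < a) (hac : a ≤ c) (hd : DifferentiableAt ℝ f c) :
    deriv f c * (a - b) ≤ f a - f b := by
  have h1 := hf.deriv_le_slope hb hc (hba.trans_le hac) hd
  have h2 : slope f b c ≤ slope f b a :=
    hf.slope_anti hb ⟨ha, by simpa using hba.ne'⟩ ⟨hc, by simpa using (hba.trans_le hac).ne'⟩ hac
  have h3 := h1.trans h2
  rwa [slope_def_field, le_div_iff₀ (by linarith)] at h3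

end ConcaveReal

/-- If the steps of a sequence are controlled by the decrease of a vanishing nonnegative potential
whenever the sequence is close to one of its cluster points, then the steps are summable. -/
theorem summable_of_local_decrease {E : Type*} [PseudoMetricSpace E] {x : ℕ → E} {p : E}
    {a P : ℕ → ℝ} {C δ : ℝ} (hC : 0 ≤ C) (hδ : 0 < δ) (ha : ∀ k, 0 ≤ a k)
    (hstep : ∀ k, dist (x (k + 1)) (x k) ≤ C * a k) (hP0 : ∀ᶠ k in atTop, 0 ≤ P k)
    (hP : Tendsto P atTop (𝓝 0)) (hcl : MapClusterPt p atTop x)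
    (hloc : ∀ᶠ k in atTop, dist (x k) p < δ → a k ≤ P k - P (k + 1)) : Summable a := by
  have hCP : Tendsto (fun k => C * P k) atTop (𝓝 0) := by simpa using hP.const_mul C
  have hev := (hP0.and hloc).and (hCP.eventually_lt_const (half_pos hδ))
  obtain ⟨N, hN⟩ := eventually_atTop.1 hev
  have hfr : ∃ᶠ k in atTop, x k ∈ Metric.ball p (δ / 2) :=
    hcl.frequently (Metric.ball_mem_nhds p (half_pos hδ))
  obtain ⟨K, hKN, hK⟩ := frequently_atTop.1 hfr N
  -- Both bounds must be proved together: the distance bound keeps the next point in the ball of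
  -- radius `δ`, since `δ / 2` is spent at the start and `C * P K < δ / 2` on the path, and only
  -- inside that ball is the next decrease available.
  have key : ∀ j, dist (x (K + j)) p ≤ dist (x K) p + C * (P K - P (K + j)) ∧
      ∑ i ∈ Finset.range j, a (K + i) ≤ P K - P (K + j) := by
    intro j
    induction j with
    | zero => simp
    | succ j ih =>
      have h1 := hN K hKN
      have h2 := hN (K + j) (by omega)
      have hd : dist (x (K + j)) p < δ := by
        have h3 : dist (x K) p < δ / 2 := hK
        have h4 : 0 ≤ C * P (K + j) := mul_nonneg hC h2.1.1
        have := ih.1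
        have h5 := h1.2
        nlinarith
      have h6 := h2.1.2 hd
      constructor
      · have h7 := dist_triangle (x (K + (j + 1))) (x (K + j)) p
        have h8 := hstep (K + j)
        have h9 := mul_le_mul_of_nonneg_left h6 hC
        have h10 := ih.1
        rw [← add_assoc] at h7 ⊢
        nlinarith
      · rw [Finset.sum_range_succ, ← add_assoc]
        linarith [ih.2]
  have hs : Summable (fun j => a (K + j)) := by
    refine summable_of_sum_range_le (c := P K) (fun j => ha _) fun j => ?_
    linarith [(key j).2, (hN (K + j) (by omega)).1.1]
  refine (summable_nat_add_iff K).1 ?_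
  simpa only [add_comm] using hs

/-! ### Calculus of Fréchet subgradients of real-valued functions. -/

section RegularSubgradient

variable {E F : Type*} [NormedAddCommGroup E] [NormedSpace ℝ E] [NormedAddCommGroup F]
  [NormedSpace ℝ F]

/-- `a` is a Fréchet subgradient of the real-valued function `f` at `x`. -/
def IsRegularSubgradient (f : E → ℝ) (x : E) (a : E →L[ℝ] ℝ) : Prop :=
  ∀ ε : ℝ, 0 < ε → ∀ᶠ y in 𝓝 x, f x + a (y - x) - ε * ‖y - x‖ ≤ f y

namespace IsRegularSubgradient

variable {f g : E → ℝ} {x : E} {a b : E →L[ℝ] ℝ}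

theorem of_forall_le (h : ∀ y, f x + a (y - x) ≤ f y) : IsRegularSubgradient f x a := by
  intro ε hε
  refine Eventually.of_forall fun y => ?_
  have := h y
  have : 0 ≤ ε * ‖y - x‖ := by positivity
  linarith

theorem add (hf : IsRegularSubgradient f x a) (hg : IsRegularSubgradient g x b) :
    IsRegularSubgradient (fun y => f y + g y) x (a + b) := by
  intro ε hε
  filter_upwards [hf _ (half_pos hε), hg _ (half_pos hε)] with y h1 h2
  simp only [add_apply]
  linarith

theorem zero : IsRegularSubgradient (fun _ : E => (0 : ℝ)) x 0 :=
  of_forall_le fun y => by simp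

theorem sum {ι : Type*} (s : Finset ι) {f : ι → E → ℝ} {a : ι → E →L[ℝ] ℝ}
    (h : ∀ i ∈ s, IsRegularSubgradient (f i) x (a i)) :
    IsRegularSubgradient (fun y => ∑ i ∈ s, f i y) x (∑ i ∈ s, a i) := by
  classical
  induction s using Finset.induction_on with
  | empty => simpa using zero
  | insert i s hi ih =>
    simp only [Finset.sum_insert hi]
    exact (h i (Finset.mem_insert_self i s)).add
      (ih fun j hj => h j (Finset.mem_insert_of_mem hj))

theorem const_mul (hf : IsRegularSubgradient f x a) {c : ℝ} (hc : 0 ≤ c) :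
    IsRegularSubgradient (fun y => c * f y) x (c • a) := by
  intro ε hε
  filter_upwards [hf (ε / (c + 1)) (by positivity)] with y h1
  have h2 := mul_le_mul_of_nonneg_left h1 hc
  have h3 : c * (ε / (c + 1) * ‖y - x‖) ≤ ε * ‖y - x‖ := by
    have : c * (ε / (c + 1)) ≤ ε := by
      rw [mul_div_assoc', div_le_iff₀ (by positivity)]
      nlinarith
    calc c * (ε / (c + 1) * ‖y - x‖) = c * (ε / (c + 1)) * ‖y - x‖ := by ring
      _ ≤ _ := by gcongr
  simp only [smul_apply, smul_eq_mul]
  linarith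

theorem of_hasFDerivAt (h : HasFDerivAt f a x) : IsRegularSubgradient f x a := by
  intro ε hε
  filter_upwards [(hasFDerivAt_iff_isLittleO.1 h).def hε] with y hy
  rw [Real.norm_eq_abs] at hy
  have := (abs_le.1 hy).1
  linarith

/-- Chain rule for an inner map that is differentiable at the point. -/
theorem comp {g : F → ℝ} {b : F →L[ℝ] ℝ} {G : E → F} {G' : E →L[ℝ] F}
    (hg : IsRegularSubgradient g (G x) b) (hG : HasFDerivAt G G' x) :
    IsRegularSubgradient (fun y => g (G y)) x (b.comp G') := by
  intro ε hε
  -- Half of `ε` pays for the subgradient error of `g`, where `‖G y - G x‖ ≤ (‖G'‖ + 1) * ‖y - x‖`;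
  -- the other half pays for `b` applied to the Taylor remainder of `G`. The cap at 1 in `ε₂` yields
  -- that Lipschitz estimate.
  set ε₁ := ε / (2 * (‖G'‖ + 1)) with hε₁
  set ε₂ := min 1 (ε / (2 * (‖b‖ + 1))) with hε₂
  have h1 : 0 < ε₁ := by positivity
  have h2 : 0 < ε₂ := by positivity
  filter_upwards [hG.continuousAt.eventually (hg ε₁ h1),
    (hasFDerivAt_iff_isLittleO.1 hG).def h2] with y hy1 hy2
  have hb : |b (G y - G x - G' (y - x))| ≤ ‖b‖ * (ε₂ * ‖y - x‖) :=
    (b.le_opNorm _).trans (by gcongr)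
  have hb1 : ‖b‖ * (ε₂ * ‖y - x‖) ≤ ε / 2 * ‖y - x‖ := by
    have h3 : ε₂ ≤ ε / (2 * (‖b‖ + 1)) := min_le_right _ _
    have h4 : ‖b‖ * ε₂ ≤ ε / 2 := by
      calc ‖b‖ * ε₂ ≤ (‖b‖ + 1) * (ε / (2 * (‖b‖ + 1))) := by gcongr; linarith
        _ = ε / 2 := by field_simp
    calc ‖b‖ * (ε₂ * ‖y - x‖) = ‖b‖ * ε₂ * ‖y - x‖ := by ring
      _ ≤ _ := by gcongr
  have hn : ‖G y - G x‖ ≤ (‖G'‖ + 1) * ‖y - x‖ := by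
    have h3 : G y - G x = (G y - G x - G' (y - x)) + G' (y - x) := by abel
    have h4 : ε₂ ≤ 1 := min_le_left _ _
    calc ‖G y - G x‖ ≤ ‖G y - G x - G' (y - x)‖ + ‖G' (y - x)‖ := by
          conv_lhs => rw [h3]
          exact norm_add_le _ _
      _ ≤ 1 * ‖y - x‖ + ‖G'‖ * ‖y - x‖ :=
          add_le_add (hy2.trans (by gcongr)) (G'.le_opNorm _)
      _ = _ := by ring
  have hn1 : ε₁ * ‖G y - G x‖ ≤ ε / 2 * ‖y - x‖ := by
    calc ε₁ * ‖G y - G x‖ ≤ ε₁ * ((‖G'‖ + 1) * ‖y - x‖) := by gcongr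
      _ = ε / 2 * ‖y - x‖ := by rw [hε₁]; field_simp
  have h5 : b (G y - G x) = b (G y - G x - G' (y - x)) + b (G' (y - x)) := by
    rw [← map_add]; congr 1; abel
  have h6 := (abs_le.1 hb).1
  simp only [ContinuousLinearMap.comp_apply]
  linarith

end IsRegularSubgradient

end RegularSubgradient

/-! ### Convex sum and chain rules by separation. -/

section ConvexSumRule

/-- Exact subdifferential sum and chain rule at a minimizer of `G (y₀ + A (x - xb)) + H x`. -/
theorem exists_subgradient_of_isMinOn {X Y : Type*} [NormedAddCommGroup X] [NormedSpace ℝ X]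
    [NormedAddCommGroup Y] [NormedSpace ℝ Y] {S : Set X} {H : X → ℝ} (hH : ConvexOn ℝ S H)
    {G : Y → ℝ} (hG : ConvexOn ℝ Set.univ G) (hGc : Continuous G) (A : X →L[ℝ] Y) (y₀ : Y) {xb : X}
    (hxb : xb ∈ S) (hmin : ∀ x ∈ S, G y₀ + H xb ≤ G (y₀ + A (x - xb)) + H x) :
    ∃ a : Y →L[ℝ] ℝ, (∀ y, G y₀ + a (y - y₀) ≤ G y) ∧
      ∀ x ∈ S, H xb ≤ H x + a (A (x - xb)) := by
  -- The open strict epigraph of `G` is separated from the points lying below `G y₀ + H xb - H x`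
  -- over `y₀ + A (x - xb)`. Disjointness is exactly minimality, and `G` being finite and continuous
  -- everywhere replaces a constraint qualification.
  set C₁ : Set (Y × ℝ) := {w | w.1 ∈ Set.univ ∧ G w.1 < w.2} with hC₁
  set C₂ : Set (Y × ℝ) :=
    {w | ∃ x ∈ S, w.1 = y₀ + A (x - xb) ∧ w.2 + H x ≤ G y₀ + H xb} with hC₂
  have hconv₁ : Convex ℝ C₁ := hG.convex_strict_epigraph
  have hopen : IsOpen C₁ := by
    have : C₁ = {w | G w.1 < w.2} := by simp [hC₁]
    rw [this]
    exact isOpen_lt (hGc.comp continuous_fst) continuous_snd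
  have hconv₂ : Convex ℝ C₂ := by
    rintro ⟨y, r⟩ ⟨x, hx, hy, hr⟩ ⟨y', r'⟩ ⟨x', hx', hy', hr'⟩ s t hs ht hst
    refine ⟨s • x + t • x', hH.1 hx hx' hs ht hst, ?_, ?_⟩
    · simp only at hy hy'
      have e1 : s • x + t • x' - xb = s • (x - xb) + t • (x' - xb) := by
        have : xb = (s + t) • xb := by rw [hst, one_smul]
        conv_lhs => rw [this]
        module
      have e2 : y₀ = (s + t) • y₀ := by rw [hst, one_smul]
      simp only [Prod.smul_mk, Prod.mk_add_mk, hy, hy', e1, map_add, map_smul]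
      conv_rhs => rw [e2]
      module
    · have h1 := hH.2 hx hx' hs ht hst
      simp only [smul_eq_mul, Prod.smul_mk, Prod.mk_add_mk] at h1 hr hr' ⊢
      have h2 := mul_le_mul_of_nonneg_left hr hs
      have h3 := mul_le_mul_of_nonneg_left hr' ht
      have h4 : s * (G y₀ + H xb) + t * (G y₀ + H xb) = G y₀ + H xb := by
        rw [← add_mul, hst, one_mul]
      linarith
  have hdisj : Disjoint C₁ C₂ := by
    rw [Set.disjoint_left]
    rintro ⟨y, r⟩ ⟨-, h1⟩ ⟨x, hx, hy, hr⟩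
    simp only at h1 hy hr
    have := hmin x hx
    rw [← hy] at this
    linarith
  obtain ⟨f, u, hf1, hf2⟩ := geometric_hahn_banach_open hconv₁ hopen hconv₂ hdisj
  set β : ℝ := f (0, 1) with hβ
  have hsplit : ∀ y r, f (y, r) = f (y, 0) + r * β := by
    intro y r
    have : ((y, r) : Y × ℝ) = (y, 0) + r • ((0, 1) : Y × ℝ) := by simp
    rw [this, map_add, map_smul, smul_eq_mul]
  have hself : u ≤ f (y₀, G y₀) := hf2 (y₀, G y₀) ⟨xb, hxb, by simp, by simp⟩
  -- The separating hyperplane is not vertical: `(y₀, G y₀)` lies in `C₂` and raising it by 1 enters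
  -- `C₁`. Dividing by `-β` turns the functional into a subgradient.
  have hβneg : β < 0 := by
    have h1 := hf1 (y₀, G y₀ + 1) ⟨trivial, by simp⟩
    rw [hsplit] at h1 hself
    linarith
  have hle : ∀ y, f (y, G y) ≤ u := by
    intro y
    refine le_of_forall_pos_le_add fun ε hε => ?_
    have h1 := hf1 (y, G y + ε / (-β)) ⟨trivial, by
      have : 0 < ε / (-β) := div_pos hε (by linarith)
      simpa using this⟩
    rw [hsplit] at h1 ⊢
    have h2 : ε / (-β) * β = -ε := by
      have := hβneg.ne
      field_simp
    linarith
  refine ⟨(-β)⁻¹ • f.comp (ContinuousLinearMap.inl ℝ Y ℝ), fun y => ?_, fun x hx => ?_⟩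
  · have h1 := (hle y).trans hself
    rw [hsplit, hsplit y₀] at h1
    have h2 : f (y - y₀, 0) = f (y, 0) - f (y₀, 0) := by
      rw [← map_sub]; simp
    have h3 : (-β)⁻¹ * f (y - y₀, 0) ≤ G y - G y₀ := by
      rw [inv_mul_le_iff₀ (by linarith), h2]
      linarith
    simp only [smul_apply, ContinuousLinearMap.comp_apply,
      ContinuousLinearMap.inl_apply, smul_eq_mul]
    linarith
  · have h1 := (hle y₀).trans (hf2 (y₀ + A (x - xb), G y₀ + H xb - H x) ⟨x, hx, rfl, by simp⟩)
    rw [hsplit, hsplit (y₀ + A (x - xb))] at h1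
    have h2 : f (y₀ + A (x - xb), 0) = f (y₀, 0) + f (A (x - xb), 0) := by
      rw [← map_add]; simp
    have h3 : H xb - H x ≤ (-β)⁻¹ * f (A (x - xb), 0) := by
      rw [le_inv_mul_iff₀ (by linarith)]
      linarith
    simp only [smul_apply, ContinuousLinearMap.comp_apply,
      ContinuousLinearMap.inl_apply, smul_eq_mul]
    linarith

/-- A subgradient of `c • f`, with `c ≥ 0`, is `c` times a subgradient of `f`. -/
theorem exists_subgradient_of_const_mul {Y : Type*} [NormedAddCommGroup Y] [NormedSpace ℝ Y]
    {f : Y → ℝ} (hf : ConvexOn ℝ Set.univ f) (hfc : Continuous f) {c : ℝ} (hc : 0 ≤ c) {y₀ : Y}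
    {a : Y →L[ℝ] ℝ} (ha : ∀ y, c * f y₀ + a (y - y₀) ≤ c * f y) :
    ∃ b : Y →L[ℝ] ℝ, a = c • b ∧ ∀ y, f y₀ + b (y - y₀) ≤ f y := by
  rcases hc.eq_or_lt with rfl | hc
  -- For `c = 0` the functional `a` vanishes, so any subgradient of `f` works; the trivial problem
  -- over `{0}` with zero linear map supplies one.
  · obtain ⟨b, hb, -⟩ := exists_subgradient_of_isMinOn (X := Y) (S := {0}) (H := fun _ => 0)
      (convexOn_const 0 (convex_singleton 0)) hf hfc 0 y₀ rfl (by simp)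
    refine ⟨b, ?_, hb⟩
    ext v
    have h1 := ha (y₀ + v)
    have h2 := ha (y₀ - v)
    simp at h1 h2 ⊢
    linarith
  · refine ⟨c⁻¹ • a, by rw [smul_smul, mul_inv_cancel₀ hc.ne', one_smul], fun y => ?_⟩
    have h1 := ha y
    have h2 : c⁻¹ * a (y - y₀) ≤ f y - f y₀ := by
      rw [inv_mul_le_iff₀ hc]; linarith
    simp only [smul_apply, smul_eq_mul]
    linarith

end ConvexSumRule

/-! ### Convex functions plus a convex quadratic. -/

section Quadratic

variable {X : Type*} [NormedAddCommGroup X] [InnerProductSpace ℝ X]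

/-- First-order optimality for the sum of a convex function and a convex quadratic. -/
theorem le_add_inner_of_isMinOn {S : Set X} {f : X → ℝ} (hf : ConvexOn ℝ S f) {Q : X →ₗ[ℝ] X}
    (hQ : Q.IsSymmetric) {z xb : X} (hxb : xb ∈ S)
    (hmin : ∀ y ∈ S, f xb + (1 / 2) * inner ℝ (xb - z) (Q (xb - z)) ≤
      f y + (1 / 2) * inner ℝ (y - z) (Q (y - z))) {y : X} (hy : y ∈ S) :
    f xb ≤ f y + inner ℝ (Q (xb - z)) (y - xb) := by
  set q : ℝ := inner ℝ (y - xb) (Q (y - xb)) with hq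
  -- Minimality is tested at the point `(1 - t) • xb + t • y`. After division by `t` the quadratic
  -- contributes only `t * (q / 2)`, which vanishes as `t → 0`.
  have key : ∀ t : ℝ, 0 < t → t ≤ 1 →
      f xb ≤ f y + inner ℝ (Q (xb - z)) (y - xb) + t * (q / 2) := by
    intro t ht ht1
    have hc := hf.2 hxb hy (sub_nonneg.2 ht1) ht.le (by ring)
    have hm := hmin _ (hf.1 hxb hy (sub_nonneg.2 ht1) ht.le (by ring))
    have e1 : (1 - t) • xb + t • y - z = (xb - z) + t • (y - xb) := by module
    have e2 : inner ℝ (xb - z) (Q (y - xb)) = inner ℝ (Q (xb - z)) (y - xb) :=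
      (hQ _ _).symm
    rw [e1] at hm
    simp only [map_add, map_smul, inner_add_left, inner_add_right, inner_smul_left,
      inner_smul_right, RCLike.conj_to_real, e2, real_inner_comm (Q (xb - z)) (y - xb)] at hm
    rw [← hq] at hm
    simp only [smul_eq_mul] at hc
    have h1 : t * f xb ≤ t * (f y + inner ℝ (Q (xb - z)) (y - xb) + t * (q / 2)) := by
      nlinarith
    exact le_of_mul_le_mul_left h1 ht
  have hlim : Tendsto (fun t : ℝ => f y + inner ℝ (Q (xb - z)) (y - xb) + t * (q / 2))
      (𝓝[>] 0) (𝓝 (f y + inner ℝ (Q (xb - z)) (y - xb) + 0 * (q / 2))) := by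
    refine Tendsto.mono_left (Continuous.tendsto (by fun_prop) 0) nhdsWithin_le_nhds
  rw [zero_mul, add_zero] at hlim
  refine ge_of_tendsto hlim ?_
  filter_upwards [Ioc_mem_nhdsGT (zero_lt_one' ℝ)] with t ht
  exact key t ht.1 ht.2

/-- Quadratic growth at a minimizer of the sum of a convex function and a convex quadratic. -/
theorem add_half_inner_le_of_isMinOn {S : Set X} {f : X → ℝ} (hf : ConvexOn ℝ S f)
    {Q : X →ₗ[ℝ] X} (hQ : Q.IsSymmetric) {z xb : X} (hxb : xb ∈ S)
    (hmin : ∀ y ∈ S, f xb + (1 / 2) * inner ℝ (xb - z) (Q (xb - z)) ≤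
      f y + (1 / 2) * inner ℝ (y - z) (Q (y - z))) {y : X} (hy : y ∈ S) :
    f xb + (1 / 2) * inner ℝ (xb - z) (Q (xb - z)) + (1 / 2) * inner ℝ (y - xb) (Q (y - xb)) ≤
      f y + (1 / 2) * inner ℝ (y - z) (Q (y - z)) := by
  have h := le_add_inner_of_isMinOn hf hQ hxb hmin hy
  have e1 : y - z = (xb - z) + (y - xb) := by abel
  have e2 : inner ℝ (xb - z) (Q (y - xb)) = inner ℝ (Q (xb - z)) (y - xb) := (hQ _ _).symm
  rw [e1]
  simp only [map_add, inner_add_left, inner_add_right, e2,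
    real_inner_comm (Q (xb - z)) (y - xb)]
  linarith

/-- Polarization replaces the spectral theorem. If `e` points along `Q d` and has the length of `d`,
then subtracting the quadratic forms at `d + e` and `d - e` isolates `4 * ‖d‖ * ‖Q d‖`. -/
theorem norm_apply_le_of_inner_le {Q : X →ₗ[ℝ] X} (hQ : Q.IsSymmetric) {c : ℝ}
    (h0 : ∀ d, 0 ≤ inner ℝ d (Q d)) (hc : ∀ d, inner ℝ d (Q d) ≤ c * ‖d‖ ^ 2) (d : X) :
    ‖Q d‖ ≤ c * ‖d‖ := by
  by_cases hQd : Q d = 0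
  · by_cases hd : d = 0
    · simp [hd]
    · have h1 := (h0 d).trans (hc d)
      have h2 : 0 < ‖d‖ := norm_pos_iff.2 hd
      rw [hQd, norm_zero]
      have h3 : 0 ≤ ‖d‖ * (c * ‖d‖) := by linarith [h1, (by ring : c * ‖d‖ ^ 2 = ‖d‖ * (c * ‖d‖))]
      exact (mul_nonneg_iff_of_pos_left h2).1 h3
  · have hn : 0 < ‖Q d‖ := norm_pos_iff.2 hQd
    have hd : 0 < ‖d‖ := norm_pos_iff.2 fun h => hQd (by simp [h])
    set e : X := (‖d‖ / ‖Q d‖) • Q d with he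
    have hen : ‖e‖ = ‖d‖ := by
      rw [he, norm_smul, Real.norm_of_nonneg (by positivity)]; field_simp
    have hin : inner ℝ d (Q e) = ‖d‖ * ‖Q d‖ := by
      rw [← hQ, he, inner_smul_right, real_inner_self_eq_norm_sq]; field_simp
    have hin' : inner ℝ e (Q d) = ‖d‖ * ‖Q d‖ := by
      rw [real_inner_comm, hQ, hin]
    have h1 := hc (d + e)
    have h2 := h0 (d - e)
    have h3 := parallelogram_law_with_norm ℝ d e
    have h4 := norm_add_sq_real d e
    have h5 : inner ℝ d e ≤ ‖d‖ * ‖d‖ := by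
      have := real_inner_le_norm d e
      rwa [hen] at this
    simp only [map_add, map_sub, inner_add_left, inner_add_right, inner_sub_left,
      inner_sub_right, hin, hin'] at h1 h2
    have h6 : 4 * (‖d‖ * ‖Q d‖) ≤ c * ‖d + e‖ ^ 2 := by linarith
    have hc0 : 0 ≤ c := by
      have h7 : 0 < c * ‖d + e‖ ^ 2 := lt_of_lt_of_le (by positivity) h6
      by_contra hneg
      push Not at hneg
      nlinarith [sq_nonneg ‖d + e‖]
    have h8 : ‖d + e‖ ^ 2 ≤ 4 * ‖d‖ ^ 2 := by
      rw [h4, hen]; nlinarith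
    have h9 : ‖d‖ * ‖Q d‖ ≤ ‖d‖ * (c * ‖d‖) := by nlinarith
    exact le_of_mul_le_mul_left h9 hd

end Quadratic


/-! ### The concave penalty. -/

section Penalty

variable {θ : ℝ → ℝ}

namespace IsPenalty

theorem differentiableAt (h : IsPenalty θ) {a : ℝ} (ha : 0 ≤ a) : DifferentiableAt ℝ θ a := by
  obtain ⟨⟨I, hI, -, hsub, -, hd, -⟩, -, -⟩ := h
  exact (hd a (hsub ha)).differentiableAt (hI.mem_nhds (hsub ha))

theorem deriv_nonneg (h : IsPenalty θ) {a : ℝ} (ha : 0 ≤ a) : 0 ≤ deriv θ a := h.2.1 a ha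

theorem le_tangent (h : IsPenalty θ) {a b : ℝ} (ha : 0 ≤ a) (hb : 0 ≤ b) :
    θ b ≤ θ a + deriv θ a * (b - a) := by
  have hd := h.differentiableAt ha
  obtain ⟨⟨I, -, -, hsub, hc, -, -⟩, -, -⟩ := h
  exact concaveOn_le_tangent hc (hsub ha) (hsub hb) hd

theorem deriv_mul_self_le (h : IsPenalty θ) {a : ℝ} (ha : 0 ≤ a) : deriv θ a * a ≤ θ a := by
  have h1 := h.le_tangent ha le_rfl
  rw [h.2.2] at h1
  linarith

theorem nonneg (h : IsPenalty θ) {a : ℝ} (ha : 0 ≤ a) : 0 ≤ θ a :=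
  (mul_nonneg (h.deriv_nonneg ha) ha).trans (h.deriv_mul_self_le ha)

theorem continuousAt_deriv (h : IsPenalty θ) {a : ℝ} (ha : 0 ≤ a) :
    ContinuousAt (deriv θ) a := by
  obtain ⟨⟨I, hI, -, hsub, -, -, hl⟩, -, -⟩ := h
  exact hl.continuousOn.continuousAt (hI.mem_nhds (hsub ha))

theorem exists_lipschitz_deriv (h : IsPenalty θ) (r : ℝ) :
    ∃ L : ℝ, 0 ≤ L ∧ ∀ a ∈ Set.Icc 0 r, ∀ b ∈ Set.Icc 0 r,
      |deriv θ b - deriv θ a| ≤ L * |b - a| := by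
  obtain ⟨⟨I, hI, -, hsub, -, -, hl⟩, -, -⟩ := h
  obtain ⟨L, hL⟩ := (hl.mono (fun x hx => hsub hx.1 : Set.Icc 0 r ⊆ I)
    ).exists_lipschitzOnWith_of_compact isCompact_Icc
  refine ⟨L, L.2, fun a ha b hb => ?_⟩
  simpa [Real.dist_eq] using hL.dist_le_mul b hb a ha

/-- Since `deriv θ |y| ≥ 0`, the subgradient inequality of the absolute value survives
multiplication by it, and the absolute value being 1-Lipschitz keeps the first-order error of `θ`
small. -/
theorem isRegularSubgradient_comp_abs (h : IsPenalty θ) {y s : ℝ}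
    (hs : ∀ r, |y| + s * (r - y) ≤ |r|) :
    IsRegularSubgradient (fun r => θ |r|) y
      ((deriv θ |y| * s) • ContinuousLinearMap.id ℝ ℝ) := by
  intro ε hε
  have h1 := IsRegularSubgradient.of_hasFDerivAt
    (h.differentiableAt (abs_nonneg y)).hasDerivAt.hasFDerivAt ε hε
  filter_upwards [continuous_abs.continuousAt.eventually h1] with r hr
  have h2 := mul_le_mul_of_nonneg_left (hs r) (h.deriv_nonneg (abs_nonneg y))
  have h3 : ε * ‖|r| - |y|‖ ≤ ε * ‖r - y‖ := by
    gcongr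
    exact abs_abs_sub_abs_le r y
  simp at hr h3 ⊢
  nlinarith

end IsPenalty

theorem abs_le_one_of_subgradient_abs {y s : ℝ} (hs : ∀ r, |y| + s * (r - y) ≤ |r|) :
    |s| ≤ 1 := by
  have h1 := hs (y + 1)
  have h2 := hs (y - 1)
  have h3 := abs_add_le y 1
  have h4 := abs_sub y 1
  rw [abs_one] at h3 h4
  rw [abs_le]
  constructor <;> linarith

end Penalty

/-! ### Limiting subgradients from global minorants. -/

section Subdifferential

variable {E : Type*} [NormedAddCommGroup E] [InnerProductSpace ℝ E]

theorem mem_limitingSubdiff_of_mem_regularSubdiff {f : E → EReal} {x v : E}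
    (h : v ∈ regularSubdiff f x) : v ∈ limitingSubdiff f x :=
  ⟨h.1, h.2.1, fun _ => x, fun _ => v, tendsto_const_nhds, tendsto_const_nhds, fun _ => h,
    tendsto_const_nhds⟩

theorem mem_limitingSubdiff_of_forall_le {f : E → EReal} {x v : E} (h1 : f x ≠ ⊤) (h2 : f x ≠ ⊥)
    (h : ∀ y, (((f x).toReal + inner ℝ v (y - x) : ℝ) : EReal) ≤ f y) :
    v ∈ limitingSubdiff f x := by
  refine mem_limitingSubdiff_of_mem_regularSubdiff ⟨h1, h2, fun ε hε => ?_⟩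
  refine Eventually.of_forall fun y => le_trans ?_ (h y)
  rw [EReal.coe_le_coe_iff]
  have : 0 ≤ ε * ‖y - x‖ := by positivity
  linarith

end Subdifferential

/-! ### Real-valued forms of the objectives, and optimality conditions of the subproblem. -/

namespace Model

variable {X : Type*} [NormedAddCommGroup X] [InnerProductSpace ℝ X] {m n p q : ℕ}
  (M : Model X m n p q)

/-- The real-valued version of `h`, meaningful on `dom h`. -/
noncomputable def hreal (x : X) : ℝ := (M.h x).toReal

/-- The real-valued version of `Θ`, meaningful on `dom h`. -/
noncomputable def thetaReal (x : X) : ℝ := ∑ i, M.θ |M.F x i| + M.ν * M.ψ (M.T x) + M.lam * M.hreal x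

/-- The convex part of the subproblem at the iterate `z`, without its constant. -/
noncomputable def convexPart (z x : X) : ℝ :=
  ∑ i, deriv M.θ |M.F z i| * |lin M.F x z i| + M.ν * M.ψ (lin M.T x z) + M.lam * M.hreal x

/-- The constant of the subproblem at the iterate `z`. -/
noncomputable def subConst (z : X) : ℝ := ∑ i, M.θ |M.F z i| - ∑ i, deriv M.θ |M.F z i| * |M.F z i|

/-- The real-valued version of the objective of the subproblem, meaningful on `dom h`. -/
noncomputable def subReal (z : X) (Q : X →ₗ[ℝ] X) (x : X) : ℝ :=
  M.convexPart z x + (1 / 2) * inner ℝ (x - z) (Q (x - z)) + M.subConst z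

/-- The part of the potential without `h`. -/
noncomputable def smoothXi (c : ℝ) (w : X × X × ℝ) : ℝ :=
  ∑ i, M.θ |lin M.F w.1 w.2.1 i| + M.ν * M.ψ (lin M.T w.1 w.2.1)
    + (c / 2) * ‖w.1 - w.2.1‖ ^ 2 + w.2.2 ^ 2

/-- `s`, `ζ` and `g` are subgradients of `|·|` (entrywise), `ψ` and `h` at the linearizations
at `z`, evaluated at `x`. -/
structure IsMultiplier (z x : X) (s : Fin m × Fin n → ℝ) (ζ : Mat p q) (g : X) : Prop where
  abs_le : ∀ i r, |lin M.F x z i| + s i * (r - lin M.F x z i) ≤ |r|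
  psi_le : ∀ y, M.ψ (lin M.T x z) + inner ℝ ζ (y - lin M.T x z) ≤ M.ψ y
  h_le : ∀ y ∈ edom M.h, M.hreal x + inner ℝ g (y - x) ≤ M.hreal y

variable {M}

theorem lin_self {Y : Type*} [NormedAddCommGroup Y] [NormedSpace ℝ Y] (G : X → Y) (z : X) :
    lin G z z = G z := by simp [lin]

theorem lin_eq_add {Y : Type*} [NormedAddCommGroup Y] [NormedSpace ℝ Y] (G : X → Y) (x y z : X) :
    lin G y z = lin G x z + fderiv ℝ G z (y - x) := by
  rw [lin, lin, add_assoc, ← map_add]; congr 2; abel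

theorem inner_mat {a b : ℕ} (u v : Mat a b) : (inner ℝ u v : ℝ) = ∑ i, u i * v i := by
  simp only [PiLp.inner_apply, RCLike.inner_apply, conj_trivial]
  exact Finset.sum_congr rfl fun i _ => mul_comm _ _

theorem convexPart_self_add_subConst (z : X) :
    M.convexPart z z + M.subConst z = M.thetaReal z := by
  simp only [convexPart, subConst, thetaReal, lin_self]; ring

theorem subReal_self (z : X) (Q : X →ₗ[ℝ] X) : M.subReal z Q z = M.thetaReal z := by
  rw [← convexPart_self_add_subConst, subReal]; simp

namespace Assumptions

theorem h_eq (hM : M.Assumptions) {x : X} (hx : x ∈ edom M.h) : M.h x = (M.hreal x : EReal) :=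
  (EReal.coe_toReal (ne_of_lt hx) (hM.h_ne_bot x)).symm

theorem convex_edom (hM : M.Assumptions) : Convex ℝ (edom M.h) := by
  intro x hx y hy a b ha hb hab
  have h1 := hM.h_convex (x := (x, M.hreal x)) (by simp [hM.h_eq hx]) (y := (y, M.hreal y))
    (by simp [hM.h_eq hy]) ha hb hab
  exact lt_of_le_of_lt h1 (EReal.coe_lt_top _)

theorem convexOn_hreal (hM : M.Assumptions) : ConvexOn ℝ (edom M.h) M.hreal := by
  refine ⟨hM.convex_edom, fun x hx y hy a b ha hb hab => ?_⟩
  have h1 := hM.h_convex (x := (x, M.hreal x)) (by simp [hM.h_eq hx]) (y := (y, M.hreal y))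
    (by simp [hM.h_eq hy]) ha hb hab
  have h2 : M.h (a • x + b • y) ≤ ((a • M.hreal x + b • M.hreal y : ℝ) : EReal) := h1
  rwa [hM.h_eq (hM.convex_edom hx hy ha hb hab), EReal.coe_le_coe_iff] at h2

theorem continuousOn_hreal (hM : M.Assumptions) : ContinuousOn M.hreal (edom M.h) :=
  hM.h_lipschitz.continuousOn

theorem convex_levelSet (hM : M.Assumptions) (c : ℝ) : Convex ℝ {x | M.h x ≤ (c : EReal)} := by
  intro x hx y hy a b ha hb hab
  have h1 := hM.h_convex (x := (x, c)) hx (y := (y, c)) hy ha hb hab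
  have h2 : M.h (a • x + b • y) ≤ ((a • c + b • c : ℝ) : EReal) := h1
  rwa [← add_smul, hab, one_smul] at h2

theorem locallyLipschitz_psi (hM : M.Assumptions) : LocallyLipschitz M.ψ :=
  hM.psi_convex.locallyLipschitz

theorem continuous_psi (hM : M.Assumptions) : Continuous M.ψ := hM.locallyLipschitz_psi.continuous

theorem real_add_mul_h (hM : M.Assumptions) (r : ℝ) {x : X} (hx : x ∈ edom M.h) :
    (r : EReal) + (M.lam : EReal) * M.h x = ((r + M.lam * M.hreal x : ℝ) : EReal) := by
  rw [hM.h_eq hx, ← EReal.coe_mul, ← EReal.coe_add]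

theorem real_add_mul_h_of_notMem (hM : M.Assumptions) (r : ℝ) {x : X} (hx : x ∉ edom M.h) :
    (r : EReal) + (M.lam : EReal) * M.h x = ⊤ := by
  have : M.h x = ⊤ := by
    by_contra h
    exact hx (lt_top_iff_ne_top.2 h)
  rw [this, EReal.coe_mul_top_of_pos hM.lam_pos, EReal.coe_add_top]

theorem Theta_eq (hM : M.Assumptions) {x : X} (hx : x ∈ edom M.h) :
    M.Theta x = (M.thetaReal x : EReal) := by
  rw [Theta, hM.real_add_mul_h _ hx]; rfl

theorem ThetaSub_eq (hM : M.Assumptions) (z : X) (Q : X →ₗ[ℝ] X) {x : X} (hx : x ∈ edom M.h) :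
    M.ThetaSub z Q x = (M.subReal z Q x : EReal) := by
  rw [ThetaSub, hM.real_add_mul_h _ hx, EReal.coe_eq_coe_iff]
  simp only [inner_mat, gradVtheta, matAbs, vtheta, subReal, convexPart, subConst]
  ring

theorem mem_edom_of_ThetaSub_ne_top (hM : M.Assumptions) {z : X} {Q : X →ₗ[ℝ] X} {x : X}
    (h : M.ThetaSub z Q x ≠ ⊤) : x ∈ edom M.h := by
  by_contra hx
  exact h (hM.real_add_mul_h_of_notMem _ hx)

theorem Xi_eq (hM : M.Assumptions) (c : ℝ) {w : WithLp 2 (X × WithLp 2 (X × ℝ))}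
    (h1 : w.fst ∈ edom M.h) (h2 : w.snd.fst ∈ M.O) :
    M.Xi c w =
      ((M.smoothXi c (w.fst, w.snd.fst, w.snd.snd) + M.lam * M.hreal w.fst : ℝ) : EReal) := by
  rw [Xi, if_pos h2, hM.real_add_mul_h _ h1]; rfl

theorem Xi_eq_top (hM : M.Assumptions) (c : ℝ) {w : WithLp 2 (X × WithLp 2 (X × ℝ))}
    (h1 : w.fst ∉ edom M.h) : M.Xi c w = ⊤ := by
  rw [Xi]
  split_ifs
  · rw [hM.real_add_mul_h_of_notMem _ h1]
  · rfl

/-- Each tangent of `θ` at a nonnegative point lies above `θ 0 = 0` at the origin. Nonnegativity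
gives lower bounds on the models that do not depend on the base point. -/
theorem subConst_nonneg (hM : M.Assumptions) (z : X) : 0 ≤ M.subConst z := by
  rw [subConst, ← Finset.sum_sub_distrib]
  exact Finset.sum_nonneg fun i _ =>
    sub_nonneg.2 (hM.penalty.deriv_mul_self_le (abs_nonneg _))

theorem exists_le_psi (hM : M.Assumptions) : ∃ b, ∀ y, b ≤ M.ψ y := by
  obtain ⟨b, hb⟩ := hM.psi_bddBelow
  exact ⟨b, fun y => hb ⟨y, rfl⟩⟩

theorem exists_le_hreal (hM : M.Assumptions) : ∃ b, ∀ x ∈ edom M.h, b ≤ M.hreal x := by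
  obtain ⟨b, hb⟩ := hM.h_bddBelow
  refine ⟨b, fun x hx => ?_⟩
  have := hb x
  rwa [hM.h_eq hx, EReal.coe_le_coe_iff] at this

theorem le_thetaReal (hM : M.Assumptions) {b : ℝ} (hb : ∀ y, b ≤ M.ψ y) (x : X) :
    M.ν * b + M.lam * M.hreal x ≤ M.thetaReal x := by
  have h1 : 0 ≤ ∑ i, M.θ |M.F x i| := Finset.sum_nonneg fun i _ =>
    hM.penalty.nonneg (abs_nonneg _)
  have h2 := mul_le_mul_of_nonneg_left (hb (M.T x)) hM.nu_nonneg
  rw [thetaReal]; linarith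

theorem le_convexPart (hM : M.Assumptions) {b : ℝ} (hb : ∀ y, b ≤ M.ψ y) (z x : X) :
    M.ν * b + M.lam * M.hreal x ≤ M.convexPart z x := by
  have h1 : 0 ≤ ∑ i, deriv M.θ |M.F z i| * |lin M.F x z i| := Finset.sum_nonneg fun i _ =>
    mul_nonneg (hM.penalty.deriv_nonneg (abs_nonneg _)) (abs_nonneg _)
  have h2 := mul_le_mul_of_nonneg_left (hb (lin M.T x z)) hM.nu_nonneg
  rw [convexPart]; linarith

/-- The finite part of the subproblem as a function of the values of the linearizations. -/
theorem convexOn_outer (hM : M.Assumptions) {c : Fin m × Fin n → ℝ} (hc : ∀ i, 0 ≤ c i) :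
    ConvexOn ℝ Set.univ (fun y : Mat m n × Mat p q => ∑ i, c i * |y.1 i| + M.ν * M.ψ y.2) := by
  have h1 : ∀ i, ConvexOn ℝ Set.univ (fun y : Mat m n × Mat p q => c i * |y.1 i|) := by
    intro i
    refine ⟨convex_univ, fun x _ y _ a b ha hb _ => ?_⟩
    have h := abs_add_le (a * x.1 i) (b * y.1 i)
    rw [abs_mul, abs_mul, abs_of_nonneg ha, abs_of_nonneg hb] at h
    have := mul_le_mul_of_nonneg_left h (hc i)
    simp only [smul_eq_mul, Prod.fst_add, Prod.smul_fst, PiLp.add_apply, PiLp.smul_apply]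
    linarith
  have h2 : ConvexOn ℝ Set.univ (fun y : Mat m n × Mat p q => ∑ i, c i * |y.1 i|) := by
    refine ⟨convex_univ, fun x _ y _ a b ha hb hab => ?_⟩
    simp only [Finset.smul_sum, ← Finset.sum_add_distrib]
    exact Finset.sum_le_sum fun i _ => (h1 i).2 trivial trivial ha hb hab
  have h3 : ConvexOn ℝ Set.univ (fun y : Mat m n × Mat p q => M.ν * M.ψ y.2) := by
    have := (hM.psi_convex.comp_linearMap (LinearMap.snd ℝ (Mat m n) (Mat p q))).smul hM.nu_nonneg
    simpa [Function.comp_def] using this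
  exact h2.add h3

theorem convexOn_convexPart (hM : M.Assumptions) (z : X) :
    ConvexOn ℝ (edom M.h) (M.convexPart z) := by
  have h1 := hM.convexOn_outer (c := fun i => deriv M.θ |M.F z i|)
    fun i => hM.penalty.deriv_nonneg (abs_nonneg _)
  have h2 : ConvexOn ℝ (edom M.h) (fun x => ∑ i, deriv M.θ |M.F z i| * |lin M.F x z i| +
      M.ν * M.ψ (lin M.T x z)) := by
    refine ⟨hM.convex_edom, fun x hx y hy a b ha hb hab => ?_⟩
    have e : ∀ {k l : ℕ} (G : X → Mat k l), lin G (a • x + b • y) z =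
        a • lin G x z + b • lin G y z := by
      intro k l G
      have e1 : a • x + b • y - z = a • (x - z) + b • (y - z) := by
        conv_lhs => rw [← one_smul ℝ z, ← hab]
        module
      rw [lin, e1, map_add, map_smul, map_smul]
      conv_lhs => rw [← one_smul ℝ (G z), ← hab]
      rw [lin, lin]; module
    have := h1.2 (x := (lin M.F x z, lin M.T x z)) trivial (y := (lin M.F y z, lin M.T y z))
      trivial ha hb hab
    simp only [e]
    exact this
  exact h2.add (hM.convexOn_hreal.smul hM.lam_pos.le)

variable [FiniteDimensional ℝ X]

/-- Optimality conditions for the linearly perturbed convex part. -/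
theorem exists_isMultiplier (hM : M.Assumptions) {z x b : X} (hx : x ∈ edom M.h)
    (hmin : ∀ y ∈ edom M.h, M.convexPart z x ≤ M.convexPart z y + inner ℝ b (y - x)) :
    ∃ s ζ g, M.IsMultiplier z x s ζ g ∧
      ∀ d, ∑ i, deriv M.θ |M.F z i| * s i * (fderiv ℝ M.F z d) i
        + M.ν * inner ℝ ζ (fderiv ℝ M.T z d) + M.lam * inner ℝ g d + inner ℝ b d = 0 := by
  have hc : ∀ i, 0 ≤ deriv M.θ |M.F z i| := fun i => hM.penalty.deriv_nonneg (abs_nonneg _)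
  set c : Fin m × Fin n → ℝ := fun i => deriv M.θ |M.F z i| with hcdef
  set G : Mat m n × Mat p q → ℝ := fun y => ∑ i, c i * |y.1 i| + M.ν * M.ψ y.2 with hG
  have hGc : Continuous G := by
    have := hM.continuous_psi
    fun_prop
  have hH : ConvexOn ℝ (edom M.h) (fun y => M.lam * M.hreal y + inner ℝ b (y - x)) := by
    refine (hM.convexOn_hreal.smul hM.lam_pos.le).add ⟨hM.convex_edom, ?_⟩
    intro u _ v _ s t _ _ hst
    have e1 : s • u + t • v - x = s • (u - x) + t • (v - x) := by
      conv_lhs => rw [← one_smul ℝ x, ← hst]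
      module
    beta_reduce
    rw [e1, inner_add_right, inner_smul_right, inner_smul_right]
    rfl
  obtain ⟨a, ha1, ha2⟩ := exists_subgradient_of_isMinOn hH (hM.convexOn_outer hc) hGc
    ((fderiv ℝ M.F z).prod (fderiv ℝ M.T z)) (lin M.F x z, lin M.T x z) hx (by
      intro y hy
      have h1 := hmin y hy
      simp only [convexPart, lin_eq_add _ x y z] at h1
      simp only [ContinuousLinearMap.prod_apply, Prod.mk_add_mk, sub_self, inner_zero_right]
      linarith)
  set a₁ : Mat m n →L[ℝ] ℝ := a.comp (ContinuousLinearMap.inl ℝ _ _) with ha₁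
  set a₂ : Mat p q →L[ℝ] ℝ := a.comp (ContinuousLinearMap.inr ℝ _ _) with ha₂
  have hsplit : ∀ u v, a (u, v) = a₁ u + a₂ v := by
    intro u v
    simp only [ha₁, ha₂, ContinuousLinearMap.comp_apply, ContinuousLinearMap.inl_apply,
      ContinuousLinearMap.inr_apply, ← map_add]
    simp
  -- Varying only entry `i` cancels the other summands, which leaves a subgradient of `c i * |·|`.
  -- Even when `c i = 0`, the factor `s` can be taken to be a genuine subgradient of the absolute
  -- value.
  have hs : ∀ i, ∃ s : ℝ, a₁ (EuclideanSpace.single i 1) = c i * s ∧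
      ∀ r, |lin M.F x z i| + s * (r - lin M.F x z i) ≤ |r| := by
    intro i
    obtain ⟨β, hβ1, hβ2⟩ := exists_subgradient_of_const_mul (Y := ℝ) (f := fun r => |r|)
      (convexOn_norm convex_univ) continuous_abs (hc i) (y₀ := lin M.F x z i)
      (a := a₁ (EuclideanSpace.single i 1) • ContinuousLinearMap.id ℝ ℝ) (by
        intro r
        have h1 := ha1 (lin M.F x z + (r - lin M.F x z i) • EuclideanSpace.single i 1,
          lin M.T x z)
        simp only [Prod.mk_sub_mk, add_sub_cancel_left, sub_self, hsplit, map_smul, map_zero,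
          add_zero, smul_eq_mul] at h1
        have h2 : ∑ j, c j * |(lin M.F x z + (r - lin M.F x z i) •
            EuclideanSpace.single i (1 : ℝ) : Mat m n) j| - ∑ j, c j * |lin M.F x z j| =
            c i * |r| - c i * |lin M.F x z i| := by
          rw [← Finset.sum_sub_distrib, Finset.sum_eq_single i]
          · simp
          · intro j _ hj
            simp [hj]
          · simp
        simp only [smul_apply, ContinuousLinearMap.id_apply, smul_eq_mul]
        linarith)
    refine ⟨β 1, ?_, fun r => ?_⟩
    · have := congrArg (fun f : ℝ →L[ℝ] ℝ => f 1) hβ1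
      simpa using this
    · have h1 := hβ2 r
      have h2 : β (r - lin M.F x z i) = (r - lin M.F x z i) * β 1 := by
        rw [← smul_eq_mul, ← map_smul]; simp
      rw [h2] at h1
      linarith
  choose s hs1 hs2 using hs
  obtain ⟨β, hβ1, hβ2⟩ := exists_subgradient_of_const_mul hM.psi_convex hM.continuous_psi
    hM.nu_nonneg (y₀ := lin M.T x z) (a := a₂) (by
      intro y
      have h1 := ha1 (lin M.F x z, y)
      simp only [Prod.mk_sub_mk, sub_self, hsplit, map_zero, zero_add] at h1
      linarith)
  have ha₁eq : ∀ v : Mat m n, a₁ v = ∑ i, c i * s i * v i := by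
    intro v
    have h1 : v = ∑ i, v i • EuclideanSpace.single i (1 : ℝ) := by
      have := (EuclideanSpace.basisFun (Fin m × Fin n) ℝ).sum_repr v
      simpa using this.symm
    conv_lhs => rw [h1]
    rw [map_sum]
    refine Finset.sum_congr rfl fun i _ => ?_
    rw [map_smul, hs1, smul_eq_mul]; ring
  set ζ : Mat p q := (InnerProductSpace.toDual ℝ (Mat p q)).symm β with hζ
  have hζ' : ∀ v, inner ℝ ζ v = β v := fun v => by
    rw [hζ, InnerProductSpace.toDual_symm_apply]
  set D : X →L[ℝ] ℝ := a.comp ((fderiv ℝ M.F z).prod (fderiv ℝ M.T z)) with hD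
  -- `g` is defined so that the stationarity identity holds exactly; that it is a subgradient of `h`
  -- is then the second half of the sum rule.
  set g : X := -(M.lam⁻¹ • ((InnerProductSpace.toDual ℝ X).symm D + b)) with hg
  have hlam := hM.lam_pos.ne'
  have hg' : ∀ d, M.lam * inner ℝ g d = -(D d + inner ℝ b d) := by
    intro d
    rw [hg, inner_neg_left, inner_smul_left, inner_add_left, InnerProductSpace.toDual_symm_apply,
      RCLike.conj_to_real]
    field_simp
  refine ⟨s, ζ, g, ⟨hs2, fun y => by rw [hζ']; exact hβ2 y, fun y hy => ?_⟩, fun d => ?_⟩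
  · have h1 := ha2 y hy
    have h2 := hg' (y - x)
    have h3 : D (y - x) = a (((fderiv ℝ M.F z).prod (fderiv ℝ M.T z)) (y - x)) := rfl
    rw [← h3] at h1
    simp only [sub_self, inner_zero_right, add_zero] at h1
    refine le_of_mul_le_mul_left ?_ hM.lam_pos
    linarith
  · have h3 : D d = a (fderiv ℝ M.F z d, fderiv ℝ M.T z d) := rfl
    rw [hg', h3, hsplit, ha₁eq, hζ', hβ1]
    simp only [smul_apply, smul_eq_mul]
    ring

end Assumptions

end Model


/-! ### Taylor estimates for linearizations. -/

section SecondOrder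

variable {X Y : Type*} [NormedAddCommGroup X] [InnerProductSpace ℝ X] [NormedAddCommGroup Y]
  [NormedSpace ℝ Y] {O K : Set X} {G : X → Y}

theorem exists_bound_of_contDiffOn (hO : IsOpen O) (hG : ContDiffOn ℝ 2 G O) (hK : IsCompact K)
    (hKc : Convex ℝ K) (hKO : K ⊆ O) :
    ∃ B : ℝ, 0 ≤ B ∧ (∀ z ∈ K, ‖fderiv ℝ G z‖ ≤ B ∧ ‖fderiv ℝ (fderiv ℝ G) z‖ ≤ B) ∧
      ∀ x ∈ K, ∀ z ∈ K, ‖G x - lin G x z‖ ≤ B * ‖x - z‖ ^ 2 ∧ ‖lin G x z‖ ≤ B := by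
  have hG' : ContDiffOn ℝ 1 (fderiv ℝ G) O := hG.fderiv_of_isOpen hO (by norm_num)
  have hG'' : ContDiffOn ℝ 0 (fderiv ℝ (fderiv ℝ G)) O := hG'.fderiv_of_isOpen hO (by norm_num)
  obtain ⟨B₀, hB₀⟩ := hK.exists_bound_of_continuousOn (hG.continuousOn.mono hKO)
  obtain ⟨B₁, hB₁⟩ := hK.exists_bound_of_continuousOn (hG'.continuousOn.mono hKO)
  obtain ⟨B₂, hB₂⟩ := hK.exists_bound_of_continuousOn (E := X →L[ℝ] X →L[ℝ] Y)
    (hG''.continuousOn.mono hKO)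
  obtain ⟨R, hR⟩ := hK.isBounded.exists_norm_le
  have hd : ∀ x ∈ K, DifferentiableAt ℝ G x := fun x hx =>
    (hG.differentiableOn (by norm_num)).differentiableAt (hO.mem_nhds (hKO hx))
  have hd' : ∀ x ∈ K, DifferentiableAt ℝ (fderiv ℝ G) x := fun x hx =>
    (hG'.differentiableOn (by norm_num)).differentiableAt (hO.mem_nhds (hKO hx))
  refine ⟨|B₀| + |B₁| + |B₂| + |B₁| * (|R| + |R|), by positivity, fun z hz => ⟨?_, ?_⟩,
    fun x hx z hz => ⟨?_, ?_⟩⟩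
  · have h1 := (hB₁ z hz).trans (le_abs_self _)
    have : 0 ≤ |B₁| * (|R| + |R|) := by positivity
    linarith [abs_nonneg B₀, abs_nonneg B₂]
  · have h1 := (hB₂ z hz).trans (le_abs_self _)
    have : 0 ≤ |B₁| * (|R| + |R|) := by positivity
    linarith [abs_nonneg B₀, abs_nonneg B₁]
  -- The mean value inequality is used twice: first for the derivative of `G`, then for `G` minus
  -- its linear part at `z`.
  · have hsub : segment ℝ z x ⊆ K := hKc.segment_subset hz hx
    have h1 : ∀ w ∈ segment ℝ z x, ‖fderiv ℝ G w - fderiv ℝ G z‖ ≤ |B₂| * ‖x - z‖ := by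
      intro w hw
      have h2 := hKc.norm_image_sub_le_of_norm_fderiv_le (𝕜 := ℝ) hd' hB₂ hz (hsub hw)
      have h3 : ‖w - z‖ ≤ ‖x - z‖ := by
        obtain ⟨t, ht, rfl⟩ := (segment_eq_image' ℝ z x).subset hw
        simp only [add_sub_cancel_left, norm_smul, Real.norm_eq_abs, abs_of_nonneg ht.1]
        exact mul_le_of_le_one_left (norm_nonneg _) ht.2
      exact h2.trans (by gcongr; exact le_abs_self _)
    have h2 := (convex_segment z x).norm_image_sub_le_of_norm_fderiv_le' (𝕜 := ℝ)
      (fun w hw => hd w (hsub hw)) h1 (left_mem_segment ℝ z x) (right_mem_segment ℝ z x)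
    have e : G x - lin G x z = G x - G z - fderiv ℝ G z (x - z) := by rw [lin]; abel
    rw [e]
    refine h2.trans ?_
    rw [mul_assoc, ← sq]
    gcongr
    have : 0 ≤ |B₁| * (|R| + |R|) := by positivity
    linarith [abs_nonneg B₀, abs_nonneg B₁]
  · rw [lin]
    calc ‖G z + fderiv ℝ G z (x - z)‖ ≤ ‖G z‖ + ‖fderiv ℝ G z‖ * ‖x - z‖ :=
          (norm_add_le _ _).trans (by gcongr; exact ContinuousLinearMap.le_opNorm _ _)
      _ ≤ |B₀| + |B₁| * (|R| + |R|) := by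
          gcongr
          · exact (hB₀ z hz).trans (le_abs_self _)
          · exact (hB₁ z hz).trans (le_abs_self _)
          · exact (norm_sub_le _ _).trans
              (add_le_add ((hR x hx).trans (le_abs_self _)) ((hR z hz).trans (le_abs_self _)))
      _ ≤ _ := by linarith [abs_nonneg B₁, abs_nonneg B₂]

/-- The derivative of the linearization jointly in both variables. -/
theorem hasFDerivAt_lin (hO : IsOpen O) (hG : ContDiffOn ℝ 2 G O) {x z : X} {t : ℝ} (hz : z ∈ O) :
    ∃ A : X × X × ℝ →L[ℝ] Y, HasFDerivAt (fun w : X × X × ℝ => lin G w.1 w.2.1) A (x, z, t) ∧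
      ∀ d, A d = fderiv ℝ G z d.1 + fderiv ℝ (fderiv ℝ G) z d.2.1 (x - z) := by
  have hG' : ContDiffOn ℝ 1 (fderiv ℝ G) O := hG.fderiv_of_isOpen hO (by norm_num)
  have h1 : HasFDerivAt G (fderiv ℝ G z) z :=
    ((hG.differentiableOn (by norm_num)).differentiableAt (hO.mem_nhds hz)).hasFDerivAt
  have h2 : HasFDerivAt (fderiv ℝ G) (fderiv ℝ (fderiv ℝ G) z) z :=
    ((hG'.differentiableOn (by norm_num)).differentiableAt (hO.mem_nhds hz)).hasFDerivAt
  have hz' : HasFDerivAt (fun w : X × X × ℝ => w.2.1) _ (x, z, t) :=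
    ((ContinuousLinearMap.fst ℝ X ℝ).comp (ContinuousLinearMap.snd ℝ X (X × ℝ))).hasFDerivAt
  have hx' : HasFDerivAt (fun w : X × X × ℝ => w.1) _ (x, z, t) :=
    (ContinuousLinearMap.fst ℝ X (X × ℝ)).hasFDerivAt
  have h3 := HasFDerivAt.comp (x, z, t) (f := fun w : X × X × ℝ => w.2.1) h1 hz'
  have h4 := HasFDerivAt.comp (x, z, t) (f := fun w : X × X × ℝ => w.2.1) h2 hz'
  refine ⟨_, h3.add (h4.clm_apply (hx'.sub hz')), fun d => ?_⟩
  simp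
  abel

end SecondOrder

/-! ### Comparison of objective, model and potential on a compact convex set. -/

namespace Model

variable {X : Type*} [NormedAddCommGroup X] [InnerProductSpace ℝ X] {m n p q : ℕ}
  {M : Model X m n p q}

variable (M) in
/-- Uniform first- and second-order estimates on a set of iterates. -/
structure LocalBounds (K : Set X) (B : ℝ) : Prop where
  nonneg : 0 ≤ B
  fderiv_F : ∀ z ∈ K, ‖fderiv ℝ M.F z‖ ≤ B
  fderiv_fderiv_F : ∀ z ∈ K, ‖fderiv ℝ (fderiv ℝ M.F) z‖ ≤ B
  fderiv_T : ∀ z ∈ K, ‖fderiv ℝ M.T z‖ ≤ B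
  fderiv_fderiv_T : ∀ z ∈ K, ‖fderiv ℝ (fderiv ℝ M.T) z‖ ≤ B
  F_sub_lin : ∀ x ∈ K, ∀ z ∈ K, ‖M.F x - lin M.F x z‖ ≤ B * ‖x - z‖ ^ 2
  deriv_le : ∀ x ∈ K, ∀ z ∈ K, ∀ i, deriv M.θ |lin M.F x z i| ≤ B
  deriv_sub_le : ∀ x ∈ K, ∀ z ∈ K, ∀ i,
    |deriv M.θ (|lin M.F x z i|) - deriv M.θ (|M.F z i|)| ≤ B * ‖x - z‖
  psi_sub_le : ∀ x ∈ K, ∀ z ∈ K, M.ψ (M.T x) - M.ψ (lin M.T x z) ≤ B * ‖x - z‖ ^ 2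
  norm_subgradient_le : ∀ x ∈ K, ∀ z ∈ K, ∀ ζ : Mat p q,
    (∀ y, M.ψ (lin M.T x z) + inner ℝ ζ (y - lin M.T x z) ≤ M.ψ y) → ‖ζ‖ ≤ B

theorem abs_lin_sub_le {K : Set X} {B : ℝ} (hB : ∀ z ∈ K, ‖fderiv ℝ M.F z‖ ≤ B) {x z : X}
    (hz : z ∈ K) (i : Fin m × Fin n) :
    |(|lin M.F x z i| - |M.F z i|)| ≤ B * ‖x - z‖ := by
  refine (abs_abs_sub_abs_le _ _).trans ?_
  have h1 : lin M.F x z i - M.F z i = (fderiv ℝ M.F z (x - z)) i := by simp [lin]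
  rw [h1]
  exact (PiLp.norm_apply_le (fderiv ℝ M.F z (x - z)) i).trans
    ((ContinuousLinearMap.le_opNorm _ _).trans (by gcongr; exact hB z hz))

theorem Assumptions.exists_localBounds (hM : M.Assumptions) {K : Set X} (hK : IsCompact K)
    (hKc : Convex ℝ K) (hKO : K ⊆ M.O) : ∃ B, M.LocalBounds K B := by
  obtain ⟨BF, hBF, hF1, hF2⟩ := exists_bound_of_contDiffOn hM.isOpen_O hM.contDiffOn_F hK hKc hKO
  obtain ⟨BT, hBT, hT1, hT2⟩ := exists_bound_of_contDiffOn hM.isOpen_O hM.contDiffOn_T hK hKc hKO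
  obtain ⟨L, hL, hθ⟩ := hM.penalty.exists_lipschitz_deriv BF
  -- The radius exceeds `BT` by 1 so that a unit step from a linearization stays in the ball; such a
  -- step along a subgradient of `ψ` bounds its norm by `P`.
  obtain ⟨P, hP⟩ := (hM.locallyLipschitz_psi.locallyLipschitzOn
    (s := Metric.closedBall 0 (BT + 1))).exists_lipschitzOnWith_of_compact
    (isCompact_closedBall _ _)
  have hP0 : (0 : ℝ) ≤ P := P.2
  have h0 := hM.penalty.deriv_nonneg le_rfl
  have hmem : ∀ x ∈ K, ∀ z ∈ K, ∀ i, |lin M.F x z i| ∈ Set.Icc 0 BF := fun x hx z hz i =>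
    ⟨abs_nonneg _, (PiLp.norm_apply_le (lin M.F x z) i).trans (hF2 x hx z hz).2⟩
  have hψ : ∀ u v : Mat p q, ‖u‖ ≤ BT + 1 → ‖v‖ ≤ BT + 1 → M.ψ u - M.ψ v ≤ P * ‖u - v‖ := by
    intro u v hu hv
    have := hP.dist_le_mul u (by simpa using hu) v (by simpa using hv)
    rw [Real.dist_eq, dist_eq_norm] at this
    exact (le_abs_self _).trans this
  have e1 : 0 ≤ L * BF := by positivity
  have e2 : 0 ≤ P * BT := by positivity
  refine ⟨BF + BT + (deriv M.θ 0 + L * BF) + P * BT + P, by positivity, ?_, ?_, ?_, ?_, ?_, ?_,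
    ?_, ?_, ?_⟩
  · exact fun z hz => (hF1 z hz).1.trans (by linarith)
  · exact fun z hz => (hF1 z hz).2.trans (by linarith)
  · exact fun z hz => (hT1 z hz).1.trans (by linarith)
  · exact fun z hz => (hT1 z hz).2.trans (by linarith)
  · exact fun x hx z hz => (hF2 x hx z hz).1.trans (by gcongr; linarith)
  · intro x hx z hz i
    have h1 := hmem x hx z hz i
    have h2 := (le_abs_self _).trans (hθ 0 ⟨le_rfl, hBF⟩ _ h1)
    rw [sub_zero, abs_of_nonneg h1.1] at h2
    have h3 := mul_le_mul_of_nonneg_left h1.2 hL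
    linarith
  · intro x hx z hz i
    have h1 := hmem z hz z hz i
    rw [lin_self] at h1
    calc |deriv M.θ (|lin M.F x z i|) - deriv M.θ (|M.F z i|)| ≤
          L * |(|lin M.F x z i| - |M.F z i|)| := hθ _ h1 _ (hmem x hx z hz i)
      _ ≤ L * (BF * ‖x - z‖) := by gcongr; exact abs_lin_sub_le (fun z hz => (hF1 z hz).1) hz i
      _ = L * BF * ‖x - z‖ := by ring
      _ ≤ _ := by gcongr; linarith
  · intro x hx z hz
    have h1 := (hT2 x hx x hx).2
    rw [lin_self] at h1
    calc M.ψ (M.T x) - M.ψ (lin M.T x z) ≤ P * ‖M.T x - lin M.T x z‖ :=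
          hψ _ _ (by linarith) (by linarith [(hT2 x hx z hz).2])
      _ ≤ P * (BT * ‖x - z‖ ^ 2) := by gcongr; exact (hT2 x hx z hz).1
      _ = P * BT * ‖x - z‖ ^ 2 := by ring
      _ ≤ _ := by gcongr; linarith
  · intro x hx z hz ζ hζ
    by_cases hζ0 : ζ = 0
    · rw [hζ0, norm_zero]; positivity
    have hn : 0 < ‖ζ‖ := norm_pos_iff.2 hζ0
    set e : Mat p q := ‖ζ‖⁻¹ • ζ with he
    have hen : ‖e‖ = 1 := by
      rw [he, norm_smul, norm_inv, norm_norm, inv_mul_cancel₀ hn.ne']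
    have h1 := hζ (lin M.T x z + e)
    have h2 : inner ℝ ζ e = ‖ζ‖ := by
      rw [he, inner_smul_right, real_inner_self_eq_norm_sq]; field_simp
    rw [add_sub_cancel_left, h2] at h1
    have h3 := (hT2 x hx z hz).2
    have h4 := hψ (lin M.T x z + e) (lin M.T x z)
      ((norm_add_le _ _).trans (by linarith)) (by linarith)
    rw [add_sub_cancel_left, hen] at h4
    linarith

namespace LocalBounds

variable {K : Set X} {B : ℝ}

/-- The subproblem objective without the proximal term majorizes `Θ` up to a quadratic. -/
theorem thetaReal_le (hB : M.LocalBounds K B) (hM : M.Assumptions) {x z : X} (hx : x ∈ K)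
    (hz : z ∈ K) : M.thetaReal x ≤ M.convexPart z x + M.subConst z +
      ((m * n : ℕ) * (B * B) + M.ν * B) * ‖x - z‖ ^ 2 := by
  have h1 : ∀ i, M.θ |M.F x i| ≤ deriv M.θ |M.F z i| * |lin M.F x z i| + (M.θ |M.F z i| -
      deriv M.θ |M.F z i| * |M.F z i|) + B * B * ‖x - z‖ ^ 2 := by
    intro i
    -- Two majorizations: `θ` by its tangent at `|F z|`, then `|F x|` by the linearization plus a
    -- Taylor remainder, the latter using `θ' ≥ 0`.
    have h2 := hM.penalty.le_tangent (abs_nonneg (M.F z i)) (abs_nonneg (M.F x i))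
    have h3 : |M.F x i| ≤ |lin M.F x z i| + B * ‖x - z‖ ^ 2 := by
      have h4 := PiLp.norm_apply_le (M.F x - lin M.F x z) i
      have h5 := h4.trans (hB.F_sub_lin x hx z hz)
      have h6 := abs_sub_abs_le_abs_sub (M.F x i) (lin M.F x z i)
      rw [PiLp.sub_apply, Real.norm_eq_abs] at h5
      linarith
    have hd := hM.penalty.deriv_nonneg (abs_nonneg (M.F z i))
    have hd' := hB.deriv_le z hz z hz i
    rw [lin_self] at hd'
    have h4 := mul_le_mul_of_nonneg_left h3 hd
    have h5 : deriv M.θ |M.F z i| * (B * ‖x - z‖ ^ 2) ≤ B * (B * ‖x - z‖ ^ 2) :=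
      mul_le_mul_of_nonneg_right hd' (mul_nonneg hB.nonneg (sq_nonneg _))
    linarith
  have h2 := Finset.sum_le_sum fun i (_ : i ∈ Finset.univ) => h1 i
  simp only [Finset.sum_add_distrib, Finset.sum_sub_distrib, Finset.sum_const, Finset.card_univ,
    Fintype.card_prod, Fintype.card_fin, nsmul_eq_mul] at h2
  have h3 := mul_le_mul_of_nonneg_left (hB.psi_sub_le x hx z hz) hM.nu_nonneg
  rw [thetaReal, convexPart, subConst]
  linarith

/-- The potential is bounded below by the subproblem objective up to a quadratic. -/
theorem le_smoothXi (hB : M.LocalBounds K B) (hM : M.Assumptions) {c : ℝ} (hc : 0 ≤ c) {x z : X}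
    (hx : x ∈ K) (hz : z ∈ K) (t : ℝ) : M.convexPart z x + M.subConst z + t ^ 2 ≤
      M.smoothXi c (x, z, t) + M.lam * M.hreal x + (m * n : ℕ) * (B * B) * ‖x - z‖ ^ 2 := by
  have h1 : ∀ i, deriv M.θ |M.F z i| * |lin M.F x z i| + (M.θ |M.F z i| -
      deriv M.θ |M.F z i| * |M.F z i|) ≤ M.θ |lin M.F x z i| + B * B * ‖x - z‖ ^ 2 := by
    intro i
    -- The tangent is taken at the linearized value, which reverses the comparison. Moving its slope
    -- back to `|F z|` costs a product of two O(‖x - z‖) differences, by the Lipschitz bound on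
    -- `deriv θ`.
    have h2 := hM.penalty.le_tangent (abs_nonneg (lin M.F x z i)) (abs_nonneg (M.F z i))
    have h3 := hB.deriv_sub_le x hx z hz i
    have h4 := abs_lin_sub_le hB.fderiv_F (x := x) hz i
    have h5 := mul_le_mul h3 h4 (abs_nonneg _) (mul_nonneg hB.nonneg (norm_nonneg _))
    rw [← abs_mul] at h5
    have h6 := (abs_le.1 h5).1
    have e1 : B * ‖x - z‖ * (B * ‖x - z‖) = B * B * ‖x - z‖ ^ 2 := by ring
    rw [e1] at h6
    linarith
  have h2 := Finset.sum_le_sum fun i (_ : i ∈ Finset.univ) => h1 i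
  simp only [Finset.sum_add_distrib, Finset.sum_sub_distrib, Finset.sum_const, Finset.card_univ,
    Fintype.card_prod, Fintype.card_fin, nsmul_eq_mul] at h2
  have h3 : 0 ≤ c / 2 * ‖x - z‖ ^ 2 := by positivity
  rw [smoothXi, convexPart, subConst]
  dsimp only
  linarith

end LocalBounds

/-- Concavity alone, through the tangent of `θ` at `|F z|`, gives this direction; no Taylor
remainder appears because both sides use the same linearization. -/
theorem Assumptions.smoothXi_le (hM : M.Assumptions) (c : ℝ) (x z : X) (t : ℝ) :
    M.smoothXi c (x, z, t) + M.lam * M.hreal x ≤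
      M.convexPart z x + M.subConst z + c / 2 * ‖x - z‖ ^ 2 + t ^ 2 := by
  have h2 := Finset.sum_le_sum fun i (_ : i ∈ Finset.univ) =>
    hM.penalty.le_tangent (abs_nonneg (M.F z i)) (abs_nonneg (lin M.F x z i))
  simp only [mul_sub, Finset.sum_add_distrib, Finset.sum_sub_distrib] at h2
  rw [smoothXi, convexPart, subConst]
  dsimp only
  linarith

/-- The Fréchet subgradient of the part of the potential without `h`. -/
theorem Assumptions.exists_isRegularSubgradient_smoothXi (hM : M.Assumptions) (c : ℝ) {x z : X}
    (t : ℝ) (hz : z ∈ M.O) {s : Fin m × Fin n → ℝ} {ζ : Mat p q} {g : X}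
    (hs : M.IsMultiplier z x s ζ g) :
    ∃ a : X × X × ℝ →L[ℝ] ℝ, IsRegularSubgradient (M.smoothXi c) (x, z, t) a ∧
      ∀ d, a d = ∑ i, deriv M.θ |lin M.F x z i| * s i * (fderiv ℝ M.F z d.1) i
        + M.ν * inner ℝ ζ (fderiv ℝ M.T z d.1)
        + ∑ i, deriv M.θ |lin M.F x z i| * s i * (fderiv ℝ (fderiv ℝ M.F) z d.2.1 (x - z)) i
        + M.ν * inner ℝ ζ (fderiv ℝ (fderiv ℝ M.T) z d.2.1 (x - z))
        + c * inner ℝ (x - z) (d.1 - d.2.1) + 2 * t * d.2.2 := by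
  obtain ⟨AF, hAF, eAF⟩ := hasFDerivAt_lin (x := x) (t := t) hM.isOpen_O hM.contDiffOn_F hz
  obtain ⟨AT, hAT, eAT⟩ := hasFDerivAt_lin (x := x) (t := t) hM.isOpen_O hM.contDiffOn_T hz
  have h1 : IsRegularSubgradient (fun w : X × X × ℝ => ∑ i, M.θ |lin M.F w.1 w.2.1 i|) (x, z, t)
      _ := IsRegularSubgradient.sum Finset.univ fun i _ =>
    (hM.penalty.isRegularSubgradient_comp_abs (hs.abs_le i)).comp
      (G := fun w : X × X × ℝ => lin M.F w.1 w.2.1 i)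
      (((EuclideanSpace.proj i : Mat m n →L[ℝ] ℝ).hasFDerivAt).comp (x, z, t)
        (f := fun w : X × X × ℝ => lin M.F w.1 w.2.1) hAF)
  have h2 : IsRegularSubgradient (fun w : X × X × ℝ => M.ν * M.ψ (lin M.T w.1 w.2.1)) (x, z, t)
      _ :=
    ((IsRegularSubgradient.of_forall_le (a := innerSL ℝ ζ) (by simpa using hs.psi_le)).comp
      (G := fun w : X × X × ℝ => lin M.T w.1 w.2.1) hAT).const_mul hM.nu_nonneg
  have hz' : HasFDerivAt (fun w : X × X × ℝ => w.2.1) _ (x, z, t) :=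
    ((ContinuousLinearMap.fst ℝ X ℝ).comp (ContinuousLinearMap.snd ℝ X (X × ℝ))).hasFDerivAt
  have hx' : HasFDerivAt (fun w : X × X × ℝ => w.1) _ (x, z, t) :=
    (ContinuousLinearMap.fst ℝ X (X × ℝ)).hasFDerivAt
  have ht' : HasFDerivAt (fun w : X × X × ℝ => w.2.2) _ (x, z, t) :=
    ((ContinuousLinearMap.snd ℝ X ℝ).comp (ContinuousLinearMap.snd ℝ X (X × ℝ))).hasFDerivAt
  have h3 := IsRegularSubgradient.of_hasFDerivAt ((hx'.sub hz').norm_sq.const_mul (c / 2))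
  have h4 := IsRegularSubgradient.of_hasFDerivAt (ht'.pow 2)
  refine ⟨_, ((h1.add h2).add h3).add h4, fun d => ?_⟩
  simp [-map_sub, eAF, eAT, inner_add_right, inner_sub_right, mul_add, Finset.sum_add_distrib]
  ring

end Model


/-! ### Subgradients of the potential at solutions of the subproblem. -/

namespace Model

variable {X : Type*} [NormedAddCommGroup X] [InnerProductSpace ℝ X] {m n p q : ℕ}
  {M : Model X m n p q}

theorem abs_sum_mul_apply_le {c : Fin m × Fin n → ℝ} {B : ℝ} (hc : ∀ i, |c i| ≤ B) (y : Mat m n) :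
    |∑ i, c i * y i| ≤ (m * n : ℕ) * (B * ‖y‖) := by
  refine (Finset.abs_sum_le_sum_abs _ _).trans ?_
  have : ∀ i ∈ Finset.univ, |c i * y i| ≤ B * ‖y‖ := fun i _ => by
    rw [abs_mul]
    exact mul_le_mul (hc i) (PiLp.norm_apply_le y i) (abs_nonneg _) ((abs_nonneg _).trans (hc i))
  simpa using Finset.sum_le_sum this

/-- A subgradient of the potential at an approximate solution of the subproblem. -/
theorem LocalBounds.exists_mem_limitingSubdiff_Xi [FiniteDimensional ℝ X] {K : Set X} {B : ℝ}
    (hB : M.LocalBounds K B) (hM : M.Assumptions) (hKS : K ⊆ edom M.h) {c : ℝ} (hc : 0 ≤ c)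
    {x z b : X} (hx : x ∈ K) (hz : z ∈ K) {s : Fin m × Fin n → ℝ} {ζ : Mat p q} {g : X}
    (hs : M.IsMultiplier z x s ζ g)
    (hkkt : ∀ d, ∑ i, deriv M.θ |M.F z i| * s i * (fderiv ℝ M.F z d) i
        + M.ν * inner ℝ ζ (fderiv ℝ M.T z d) + M.lam * inner ℝ g d + inner ℝ b d = 0) (t : ℝ) :
    ∃ v ∈ limitingSubdiff (M.Xi c) (WithLp.toLp 2 (x, WithLp.toLp 2 (z, t))),
      ‖v‖ ≤ (2 * ((m * n : ℕ) * (B * B)) + M.ν * (B * B) + 2 * c) * ‖x - z‖ + ‖b‖ + 2 * |t| := by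
  have hzO := hM.edom_subset (hKS hz)
  have hxS := hKS hx
  obtain ⟨a, ha, hae⟩ := hM.exists_isRegularSubgradient_smoothXi c t hzO hs
  set W := WithLp 2 (X × WithLp 2 (X × ℝ))
  set w₀ : W := WithLp.toLp 2 (x, WithLp.toLp 2 (z, t)) with hw₀
  set Pf : W →L[ℝ] X := WithLp.fstL 2 ℝ X (WithLp 2 (X × ℝ)) with hPf
  set Ps : W →L[ℝ] WithLp 2 (X × ℝ) := WithLp.sndL 2 ℝ X (WithLp 2 (X × ℝ)) with hPs
  set Pz : W →L[ℝ] X := (WithLp.fstL 2 ℝ X ℝ).comp Ps with hPz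
  set Pt : W →L[ℝ] ℝ := (WithLp.sndL 2 ℝ X ℝ).comp Ps with hPt
  set P : W →L[ℝ] X × X × ℝ := Pf.prod (Pz.prod Pt) with hP
  have ePf : ∀ w, Pf w = w.fst := fun w => rfl
  have ePz : ∀ w, Pz w = w.snd.fst := fun w => rfl
  have ePt : ∀ w, Pt w = w.snd.snd := fun w => rfl
  have nf : ∀ w, ‖Pf w‖ ≤ ‖w‖ := fun w => WithLp.norm_fst_le X w
  have ns : ∀ w, ‖Ps w‖ ≤ ‖w‖ := fun w => WithLp.norm_snd_le _ w
  have nz : ∀ w, ‖Pz w‖ ≤ ‖w‖ := fun w => (WithLp.norm_fst_le _ (Ps w)).trans (ns w)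
  have nt : ∀ w, ‖Pt w‖ ≤ ‖w‖ := fun w => (WithLp.norm_snd_le _ (Ps w)).trans (ns w)
  have hreg : IsRegularSubgradient (fun w => M.smoothXi c (P w)) w₀ (a.comp P) :=
    IsRegularSubgradient.comp (G := fun w => P w) (x := w₀) ha P.hasFDerivAt
  -- The Fréchet subgradient of the part without `h` plus `lam` times the convex subgradient of `h`;
  -- outside dom h the potential is infinite and there is nothing to check.
  set f : W →L[ℝ] ℝ := a.comp P + M.lam • (innerSL ℝ g).comp Pf with hf
  set v : W := (InnerProductSpace.toDual ℝ W).symm f with hv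
  have hvin : ∀ w, inner ℝ v w = f w := fun w => by
    rw [hv, InnerProductSpace.toDual_symm_apply]
  have hXi₀ := hM.Xi_eq c (w := w₀) hxS hzO
  refine ⟨v, mem_limitingSubdiff_of_mem_regularSubdiff ⟨?_, ?_, fun ε hε => ?_⟩, ?_⟩
  · rw [hXi₀]; exact EReal.coe_ne_top _
  · rw [hXi₀]; exact EReal.coe_ne_bot _
  · have hO : ∀ᶠ w in 𝓝 w₀, Pz w ∈ M.O :=
      Pz.continuous.continuousAt.eventually (hM.isOpen_O.mem_nhds hzO)
    filter_upwards [hreg ε hε, hO] with w hw1 hw2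
    by_cases hw : w.fst ∈ edom M.h
    · rw [hXi₀, hM.Xi_eq c hw hw2, EReal.toReal_coe, EReal.coe_le_coe_iff, hvin, hf]
      have h1 := hs.h_le _ hw
      have h2 := mul_le_mul_of_nonneg_left h1 hM.lam_pos.le
      have e1 : (innerSL ℝ g).comp Pf (w - w₀) = inner ℝ g (w.fst - x) := rfl
      simp only [add_apply, smul_apply, e1, smul_eq_mul]
      have h3 : M.smoothXi c (P w₀) = M.smoothXi c (w₀.fst, w₀.snd.fst, w₀.snd.snd) := rfl
      have h4 : M.smoothXi c (P w) = M.smoothXi c (w.fst, w.snd.fst, w.snd.snd) := rfl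
      have h5 : w₀.fst = x := rfl
      replace hw1 : M.smoothXi c (P w₀) + (a.comp P) (w - w₀) - ε * ‖w - w₀‖ ≤
        M.smoothXi c (P w) := hw1
      rw [h3, h4] at hw1
      rw [h5] at hw1 ⊢
      linarith
    · rw [hM.Xi_eq_top c hw]; exact le_top
  · rw [hv, LinearIsometryEquiv.norm_map]
    have hν := hM.nu_nonneg
    have hB0 := hB.nonneg
    refine f.opNorm_le_bound (by positivity) fun w => ?_
    set d := P w with hd
    have n1 : ‖d.1‖ ≤ ‖w‖ := nf w
    have n2 : ‖d.2.1‖ ≤ ‖w‖ := nz w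
    have n3 : |d.2.2| ≤ ‖w‖ := nt w
    have hfw : f w = a d + M.lam * inner ℝ g d.1 := rfl
    have hs1 : ∀ i, |s i| ≤ 1 := fun i => abs_le_one_of_subgradient_abs (hs.abs_le i)
    -- Subtracting the optimality condition removes `g` and the first-order terms, apart from the
    -- discrepancy between `deriv θ` at the linearized and at the old value; like the
    -- second-derivative and proximal terms, this is O(‖x - z‖). Only `b` and `t` remain besides.
    have hk := hkkt d.1
    have e1 : ∑ i, (deriv M.θ |lin M.F x z i| - deriv M.θ |M.F z i|) * s i *
        (fderiv ℝ M.F z d.1) i = ∑ i, deriv M.θ |lin M.F x z i| * s i * (fderiv ℝ M.F z d.1) i -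
          ∑ i, deriv M.θ |M.F z i| * s i * (fderiv ℝ M.F z d.1) i := by
      rw [← Finset.sum_sub_distrib]
      exact Finset.sum_congr rfl fun i _ => by ring
    have b1 : |∑ i, (deriv M.θ |lin M.F x z i| - deriv M.θ |M.F z i|) * s i *
        (fderiv ℝ M.F z d.1) i| ≤ (m * n : ℕ) * (B * ‖x - z‖ * (B * ‖w‖)) := by
      refine (abs_sum_mul_apply_le (B := B * ‖x - z‖) (fun i => ?_) _).trans ?_
      · rw [abs_mul]
        calc _ ≤ B * ‖x - z‖ * 1 :=
              mul_le_mul (hB.deriv_sub_le x hx z hz i) (hs1 i) (abs_nonneg _) (by positivity)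
          _ = _ := mul_one _
      · gcongr
        exact (ContinuousLinearMap.le_opNorm _ _).trans
          (mul_le_mul (hB.fderiv_F z hz) n1 (norm_nonneg _) hB0)
    have b2 : |∑ i, deriv M.θ |lin M.F x z i| * s i *
        (fderiv ℝ (fderiv ℝ M.F) z d.2.1 (x - z)) i| ≤
          (m * n : ℕ) * (B * (B * ‖w‖ * ‖x - z‖)) := by
      refine (abs_sum_mul_apply_le (B := B) (fun i => ?_) _).trans ?_
      · rw [abs_mul, abs_of_nonneg (hM.penalty.deriv_nonneg (abs_nonneg _))]
        calc _ ≤ B * 1 := mul_le_mul (hB.deriv_le x hx z hz i) (hs1 i) (abs_nonneg _) hB0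
          _ = _ := mul_one _
      · gcongr
        refine (ContinuousLinearMap.le_opNorm₂ _ _ _).trans ?_
        gcongr
        exact hB.fderiv_fderiv_F z hz
    have b3 : |inner ℝ ζ (fderiv ℝ (fderiv ℝ M.T) z d.2.1 (x - z))| ≤
        B * (B * ‖w‖ * ‖x - z‖) := by
      refine (abs_real_inner_le_norm _ _).trans (mul_le_mul
        (hB.norm_subgradient_le x hx z hz ζ hs.psi_le) ?_ (norm_nonneg _) hB0)
      refine (ContinuousLinearMap.le_opNorm₂ _ _ _).trans ?_
      gcongr
      exact hB.fderiv_fderiv_T z hz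
    have b4 : |inner ℝ (x - z) (d.1 - d.2.1)| ≤ ‖x - z‖ * (2 * ‖w‖) := by
      refine (abs_real_inner_le_norm _ _).trans ?_
      gcongr
      exact (norm_sub_le _ _).trans (by linarith)
    have b5 : |inner ℝ b d.1| ≤ ‖b‖ * ‖w‖ :=
      (abs_real_inner_le_norm _ _).trans (by gcongr)
    have b6 : |2 * t * d.2.2| ≤ 2 * |t| * ‖w‖ := by
      rw [abs_mul, abs_mul, abs_two]; gcongr
    have b3' := mul_le_mul_of_nonneg_left b3 hν
    have b4' := mul_le_mul_of_nonneg_left b4 hc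
    rw [← abs_of_nonneg hν, ← abs_mul, abs_of_nonneg hν] at b3'
    rw [← abs_of_nonneg hc, ← abs_mul, abs_of_nonneg hc] at b4'
    rw [hfw, hae, Real.norm_eq_abs, abs_le]
    rw [abs_le] at b1 b2 b3' b4' b5 b6
    constructor <;> linarith [b1.1, b1.2, b2.1, b2.2, b3'.1, b3'.2, b4'.1, b4'.2, b5.1, b5.2,
      b6.1, b6.2]

/-! ### Descent, compactness and bounded proximal parameters. -/

namespace Run

variable (R : M.Run)

theorem x_mem (hM : M.Assumptions) (k : ℕ) : R.x k ∈ edom M.h := by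
  cases k with
  | zero => exact R.x_zero_mem
  | succ k =>
    rw [R.x_succ]
    exact hM.mem_edom_of_ThetaSub_ne_top (R.inexact_decrease k _ le_rfl).ne_top

theorem xin_mem (hM : M.Assumptions) {k j : ℕ} (hj : j ≤ R.jlast k) : R.xin k j ∈ edom M.h :=
  hM.mem_edom_of_ThetaSub_ne_top (R.inexact_decrease k j hj).ne_top

theorem xopt_mem (hM : M.Assumptions) {k j : ℕ} (hj : j ≤ R.jlast k) : R.xopt k j ∈ edom M.h :=
  hM.mem_edom_of_ThetaSub_ne_top
    ((R.xopt_min k j hj (R.xin k j)).trans_lt (R.inexact_decrease k j hj)).ne_top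

theorem subReal_xin_lt (hM : M.Assumptions) {k j : ℕ} (hj : j ≤ R.jlast k) :
    M.subReal (R.x k) (R.Q k j) (R.xin k j) < M.thetaReal (R.x k) := by
  have := R.inexact_decrease k j hj
  rwa [hM.Theta_eq (R.x_mem hM k), hM.ThetaSub_eq _ _ (R.xin_mem hM hj),
    EReal.coe_lt_coe_iff] at this

theorem subReal_xopt_le (hM : M.Assumptions) {k j : ℕ} (hj : j ≤ R.jlast k) {y : X}
    (hy : y ∈ edom M.h) :
    M.subReal (R.x k) (R.Q k j) (R.xopt k j) ≤ M.subReal (R.x k) (R.Q k j) y := by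
  have := R.xopt_min k j hj y
  rwa [hM.ThetaSub_eq _ _ (R.xopt_mem hM hj), hM.ThetaSub_eq _ _ hy, EReal.coe_le_coe_iff] at this

theorem subReal_gap (hM : M.Assumptions) {k j : ℕ} (hj : j ≤ R.jlast k) :
    M.subReal (R.x k) (R.Q k j) (R.xin k j) - M.subReal (R.x k) (R.Q k j) (R.xopt k j) ≤
      R.μup / 2 * (M.thetaReal (R.x k) - M.subReal (R.x k) (R.Q k j) (R.xin k j)) := by
  have := R.inexact_gap k j hj
  rw [hM.Theta_eq (R.x_mem hM k), hM.ThetaSub_eq _ _ (R.xin_mem hM hj),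
    hM.ThetaSub_eq _ _ (R.xopt_mem hM hj), ← EReal.coe_sub, ← EReal.coe_sub, ← EReal.coe_mul,
    EReal.coe_le_coe_iff] at this
  refine this.trans (mul_le_mul_of_nonneg_right ?_ (sub_nonneg.2 (R.subReal_xin_lt hM hj).le))
  linarith [R.μ_le k]

theorem subReal_lt_of_reject (hM : M.Assumptions) {k j : ℕ} (hj : j < R.jlast k) :
    M.subReal (R.x k) (R.Q k j) (R.xin k j) < M.thetaReal (R.xin k j) := by
  have := R.inner_reject k j hj
  rwa [hM.Theta_eq (R.xin_mem hM hj.le), hM.ThetaSub_eq _ _ (R.xin_mem hM hj.le),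
    EReal.coe_lt_coe_iff] at this

theorem thetaReal_succ_le (hM : M.Assumptions) (k : ℕ) : M.thetaReal (R.x (k + 1)) ≤
    M.subReal (R.x k) (R.Q k (R.jlast k)) (R.x (k + 1)) := by
  have := R.inner_accept k
  rw [R.x_succ]
  rwa [hM.Theta_eq (R.xin_mem hM le_rfl), hM.ThetaSub_eq _ _ (R.xin_mem hM le_rfl),
    EReal.coe_le_coe_iff] at this

theorem γlow_le {k j : ℕ} (hj : j ≤ R.jlast k) : R.γlow ≤ R.γ k j := by
  induction j with
  | zero => exact (R.γ_init k).1
  | succ j ih =>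
    rw [R.γ_succ k j hj]
    have := ih (by omega)
    have h1 := R.one_lt_rho
    have h2 := R.γlow_pos
    nlinarith

/-- The model decrease achieved by the trial point. -/
noncomputable def decrease (k j : ℕ) : ℝ :=
  M.thetaReal (R.x k) - M.subReal (R.x k) (R.Q k j) (R.xin k j)

theorem decrease_pos (hM : M.Assumptions) {k j : ℕ} (hj : j ≤ R.jlast k) : 0 < R.decrease k j :=
  sub_pos.2 (R.subReal_xin_lt hM hj)

theorem growth (hM : M.Assumptions) {k j : ℕ} (hj : j ≤ R.jlast k) {y : X} (hy : y ∈ edom M.h) :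
    M.subReal (R.x k) (R.Q k j) (R.xopt k j) + R.γ k j / 2 * ‖y - R.xopt k j‖ ^ 2 ≤
      M.subReal (R.x k) (R.Q k j) y := by
  have h1 := add_half_inner_le_of_isMinOn (hM.convexOn_convexPart (R.x k)) (R.Q_symm k j hj)
    (z := R.x k) (R.xopt_mem hM hj) (fun y hy => by
      have := R.subReal_xopt_le hM hj hy
      rw [subReal, subReal] at this
      linarith) hy
  have h2 := R.Q_lower k j hj (y - R.xopt k j)
  rw [subReal, subReal]
  linarith

/-- Quadratic growth is tested at the current iterate, where the model equals `Θ`; the gap from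
there to the exact minimum is at most `1 + μup / 2` times the decrease. -/
theorem norm_xopt_sub_sq_le (hM : M.Assumptions) {k j : ℕ} (hj : j ≤ R.jlast k) :
    R.γlow * ‖R.xopt k j - R.x k‖ ^ 2 ≤ (2 + R.μup) * R.decrease k j := by
  have h1 := R.growth hM hj (R.x_mem hM k)
  rw [subReal_self] at h1
  have h2 := R.subReal_gap hM hj
  have h3 := mul_le_mul_of_nonneg_right (R.γlow_le hj) (sq_nonneg ‖R.xopt k j - R.x k‖)
  rw [norm_sub_rev] at h1
  rw [decrease]
  linarith

/-- Growth tested at the inexact point bounds its distance to the exact minimizer through the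
inexactness gap; squaring the triangle inequality then gives `2 * μup + 2 * (2 + μup)`, the stated
factor. -/
theorem norm_xin_sub_sq_le (hM : M.Assumptions) {k j : ℕ} (hj : j ≤ R.jlast k) :
    R.γlow * ‖R.xin k j - R.x k‖ ^ 2 ≤ 4 * (1 + R.μup) * R.decrease k j := by
  have h1 := R.norm_xopt_sub_sq_le hM hj
  have h2 := R.growth hM hj (R.xin_mem hM hj)
  have h3 := R.subReal_gap hM hj
  have h4 := mul_le_mul_of_nonneg_right (R.γlow_le hj) (sq_nonneg ‖R.xin k j - R.xopt k j‖)
  have h5 : ‖R.xin k j - R.x k‖ ^ 2 ≤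
      2 * ‖R.xin k j - R.xopt k j‖ ^ 2 + 2 * ‖R.xopt k j - R.x k‖ ^ 2 := by
    have h6 : ‖R.xin k j - R.x k‖ ≤ ‖R.xin k j - R.xopt k j‖ + ‖R.xopt k j - R.x k‖ :=
      norm_sub_le_norm_sub_add_norm_sub _ _ _
    have h7 := pow_le_pow_left₀ (norm_nonneg _) h6 2
    nlinarith [sq_nonneg (‖R.xin k j - R.xopt k j‖ - ‖R.xopt k j - R.x k‖)]
  have h6 := mul_le_mul_of_nonneg_left h5 R.γlow_pos.le
  rw [decrease] at h1 ⊢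
  linarith

theorem thetaReal_antitone (hM : M.Assumptions) : Antitone fun k => M.thetaReal (R.x k) := by
  refine antitone_nat_of_succ_le fun k => (R.thetaReal_succ_le hM k).trans ?_
  rw [R.x_succ]
  exact (R.subReal_xin_lt hM le_rfl).le

theorem decrease_le (hM : M.Assumptions) (k : ℕ) :
    R.decrease k (R.jlast k) ≤ M.thetaReal (R.x k) - M.thetaReal (R.x (k + 1)) := by
  have := R.thetaReal_succ_le hM k
  rw [R.x_succ] at this
  rw [decrease, R.x_succ]
  linarith

/-- All iterates and trial points of a bounded run lie in a compact convex subset of `dom h`. -/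
theorem exists_compact [FiniteDimensional ℝ X] (hM : M.Assumptions)
    (hbdd : Bornology.IsBounded (Set.range R.x)) :
    ∃ K : Set X, IsCompact K ∧ Convex ℝ K ∧ K ⊆ edom M.h ∧
      ∀ k, R.x k ∈ K ∧ ∀ j ≤ R.jlast k, R.xin k j ∈ K ∧ R.xopt k j ∈ K := by
  obtain ⟨bψ, hbψ⟩ := hM.exists_le_psi
  obtain ⟨bh, hbh⟩ := hM.exists_le_hreal
  obtain ⟨r, hr⟩ := hbdd.exists_norm_le
  set Θ₀ := M.thetaReal (R.x 0) with hΘ₀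
  have hanti : ∀ k, M.thetaReal (R.x k) ≤ Θ₀ := fun k => R.thetaReal_antitone hM (Nat.zero_le k)
  set Dmax := Θ₀ - (M.ν * bψ + M.lam * bh) with hDmax
  have hsub : ∀ k j, j ≤ R.jlast k → ∀ y, M.ν * bψ + M.lam * M.hreal y ≤
      M.subReal (R.x k) (R.Q k j) y := by
    intro k j hj y
    have h1 := hM.le_convexPart hbψ (R.x k) y
    have h2 := hM.subConst_nonneg (R.x k)
    have h3 := R.Q_lower k j hj (y - R.x k)
    have h4 : 0 ≤ R.γ k j * ‖y - R.x k‖ ^ 2 :=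
      mul_nonneg (R.γlow_pos.le.trans (R.γlow_le hj)) (sq_nonneg _)
    rw [subReal]; linarith
  have hD : ∀ k j, j ≤ R.jlast k → R.decrease k j ≤ Dmax := by
    intro k j hj
    have h1 := hsub k j hj (R.xin k j)
    have h2 := mul_le_mul_of_nonneg_left (hbh _ (R.xin_mem hM hj)) hM.lam_pos.le
    have h3 := hanti k
    rw [decrease, hDmax]; linarith
  -- Every relevant point has model or objective value at most `Θ₀`, which forces `h ≤ cK`. This
  -- sublevel set is closed and convex, and lies in dom h; the ball supplies compactness.
  set cK := (Θ₀ - M.ν * bψ) / M.lam with hcK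
  set E := 4 * (1 + R.μup) * Dmax / R.γlow with hE
  have hμ := R.μup_pos
  have hγ := R.γlow_pos
  have hlev : ∀ y ∈ edom M.h, M.ν * bψ + M.lam * M.hreal y ≤ Θ₀ → M.h y ≤ (cK : EReal) := by
    intro y hy h
    rw [hM.h_eq hy, EReal.coe_le_coe_iff, hcK, le_div_iff₀ hM.lam_pos]
    linarith
  have hball : ∀ k (y : X), R.γlow * ‖y - R.x k‖ ^ 2 ≤ 4 * (1 + R.μup) * Dmax →
      ‖y‖ ≤ r + (1 + E) := by
    intro k y h
    have h1 : ‖y - R.x k‖ ^ 2 ≤ E := by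
      rw [hE, le_div_iff₀ hγ]; linarith
    have h2 : ‖y - R.x k‖ ≤ 1 + E := by nlinarith [sq_nonneg (‖y - R.x k‖ - 1)]
    have h3 := hr _ (Set.mem_range_self k)
    have h4 : ‖y‖ ≤ ‖R.x k‖ + ‖y - R.x k‖ := by
      have := norm_add_le (R.x k) (y - R.x k)
      rwa [add_sub_cancel] at this
    linarith
  refine ⟨{x | M.h x ≤ (cK : EReal)} ∩ Metric.closedBall 0 (r + (1 + E)), ?_, ?_, ?_, ?_⟩
  · exact (isCompact_closedBall _ _).inter_left (hM.h_lsc.isClosed_preimage _)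
  · exact (hM.convex_levelSet cK).inter (convex_closedBall _ _)
  · exact fun x hx => lt_of_le_of_lt hx.1 (EReal.coe_lt_top _)
  · refine fun k => ⟨⟨hlev _ (R.x_mem hM k) ?_, ?_⟩, fun j hj =>
      ⟨⟨hlev _ (R.xin_mem hM hj) ?_, ?_⟩, ⟨hlev _ (R.xopt_mem hM hj) ?_, ?_⟩⟩⟩
    · exact (hM.le_thetaReal hbψ _).trans (hanti k)
    · rw [mem_closedBall_zero_iff]
      have hD0 := (R.decrease_pos hM (le_refl (R.jlast k))).le.trans (hD k _ le_rfl)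
      refine hball k _ ?_
      rw [sub_self, norm_zero]
      have : 0 ≤ 4 * (1 + R.μup) * Dmax := by positivity
      simpa using this
    · exact ((hsub k j hj _).trans (R.subReal_xin_lt hM hj).le).trans (hanti k)
    · rw [mem_closedBall_zero_iff]
      refine hball k _ ((R.norm_xin_sub_sq_le hM hj).trans ?_)
      exact mul_le_mul_of_nonneg_left (hD k j hj) (by positivity)
    · refine ((hsub k j hj _).trans (R.subReal_xopt_le hM hj (R.x_mem hM k))).trans ?_
      rw [subReal_self]; exact hanti k
    · rw [mem_closedBall_zero_iff]
      refine hball k _ ((R.norm_xopt_sub_sq_le hM hj).trans ?_)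
      refine mul_le_mul (by linarith) (hD k j hj) (R.decrease_pos hM hj).le (by positivity)

/-- The proximal parameters of a bounded run are bounded. -/
theorem exists_γ_le (hM : M.Assumptions) {K : Set X} {B : ℝ} (hB : M.LocalBounds K B)
    (hK : ∀ k, R.x k ∈ K ∧ ∀ j ≤ R.jlast k, R.xin k j ∈ K ∧ R.xopt k j ∈ K) :
    ∃ Γ : ℝ, 0 ≤ Γ ∧ ∀ k, ∀ j ≤ R.jlast k, R.γ k j ≤ Γ := by
  set C : ℝ := (m * n : ℕ) * (B * B) + M.ν * B with hC
  have hC0 : 0 ≤ C := by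
    have := hM.nu_nonneg
    have := hB.nonneg
    positivity
  have hρ := R.one_lt_rho
  have hγup : 0 < R.γup := R.γlow_pos.trans R.γlow_lt
  have h0 : 0 ≤ R.rho * (2 * C) := by positivity
  refine ⟨R.γup + R.rho * (2 * C), by positivity, fun k j hj => ?_⟩
  cases j with
  | zero => linarith [(R.γ_init k).2]
  | succ j =>
    have hj' : j ≤ R.jlast k := by omega
    rw [R.γ_succ k j hj]
    -- A rejected trial point violates the majorization, so its proximal term is smaller than the
    -- quadratic error `C * ‖x - z‖ ^ 2`. Hence `γ < 2 * C` before the last multiplication by `rho`.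
    have h1 := R.subReal_lt_of_reject hM hj
    have h2 := hB.thetaReal_le hM ((hK k).2 j hj').1 (hK k).1
    have h3 := R.Q_lower k j hj' (R.xin k j - R.x k)
    rw [subReal] at h1
    have h4 : R.γ k j * ‖R.xin k j - R.x k‖ ^ 2 < 2 * C * ‖R.xin k j - R.x k‖ ^ 2 := by
      linarith
    have h5 : R.γ k j < 2 * C := lt_of_mul_lt_mul_right h4 (sq_nonneg _)
    have h6 : R.rho * R.γ k j ≤ R.rho * (2 * C) := by gcongr
    linarith

end Run

end Model


/-! ### Limits and stationarity. -/

namespace Model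

variable {X : Type*} [NormedAddCommGroup X] [InnerProductSpace ℝ X] {m n p q : ℕ}
  {M : Model X m n p q}

section Limits

variable {Y : Type*} [NormedAddCommGroup Y] [NormedSpace ℝ Y]

theorem tendsto_lin {ι : Type*} {l : Filter ι} {O : Set X} {G : X → Y} (hO : IsOpen O)
    (hG : ContDiffOn ℝ 2 G O) {x z : ι → X} {x₀ z₀ : X} (hz₀ : z₀ ∈ O) (hx : Tendsto x l (𝓝 x₀))
    (hz : Tendsto z l (𝓝 z₀)) : Tendsto (fun i => lin G (x i) (z i)) l (𝓝 (lin G x₀ z₀)) := by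
  have hG' : ContDiffOn ℝ 1 (fderiv ℝ G) O := hG.fderiv_of_isOpen hO (by norm_num)
  have h1 : ContinuousAt G z₀ := hG.continuousOn.continuousAt (hO.mem_nhds hz₀)
  have h2 : ContinuousAt (fderiv ℝ G) z₀ := hG'.continuousOn.continuousAt (hO.mem_nhds hz₀)
  have h3 : Tendsto (fun i => fderiv ℝ G (z i)) l (𝓝 (fderiv ℝ G z₀)) := h2.tendsto.comp hz
  exact (h1.tendsto.comp hz).add
    ((isBoundedBilinearMap_apply.continuous.tendsto (fderiv ℝ G z₀, x₀ - z₀)).comp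
      (h3.prodMk_nhds (hx.sub hz)))

theorem tendsto_mat_apply {ι : Type*} {l : Filter ι} {a b : ℕ} {y : ι → Mat a b} {y₀ : Mat a b}
    (hy : Tendsto y l (𝓝 y₀)) (i : Fin a × Fin b) : Tendsto (fun k => y k i) l (𝓝 (y₀ i)) :=
  ((EuclideanSpace.proj i : Mat a b →L[ℝ] ℝ).continuous.tendsto y₀).comp hy

theorem Assumptions.tendsto_hreal (hM : M.Assumptions) {ι : Type*} {l : Filter ι} {x : ι → X}
    {x₀ : X} (hx₀ : x₀ ∈ edom M.h) (hxS : ∀ i, x i ∈ edom M.h) (hx : Tendsto x l (𝓝 x₀)) :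
    Tendsto (fun i => M.hreal (x i)) l (𝓝 (M.hreal x₀)) :=
  (hM.continuousOn_hreal x₀ hx₀).tendsto.comp
    (tendsto_nhdsWithin_iff.2 ⟨hx, Eventually.of_forall hxS⟩)

theorem Assumptions.tendsto_convexPart (hM : M.Assumptions) {ι : Type*} {l : Filter ι}
    {x z : ι → X} {x₀ z₀ : X} (hz₀ : z₀ ∈ M.O) (hx₀ : x₀ ∈ edom M.h)
    (hxS : ∀ i, x i ∈ edom M.h) (hx : Tendsto x l (𝓝 x₀)) (hz : Tendsto z l (𝓝 z₀)) :
    Tendsto (fun i => M.convexPart (z i) (x i)) l (𝓝 (M.convexPart z₀ x₀)) := by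
  have hF := tendsto_lin hM.isOpen_O hM.contDiffOn_F hz₀ hx hz
  have hF' := tendsto_lin hM.isOpen_O hM.contDiffOn_F hz₀ hz hz
  simp only [lin_self] at hF'
  have hT := tendsto_lin hM.isOpen_O hM.contDiffOn_T hz₀ hx hz
  refine ((tendsto_finsetSum _ fun i _ => ?_).add
    (((hM.continuous_psi.tendsto _).comp hT).const_mul _)).add
    ((hM.tendsto_hreal hx₀ hxS hx).const_mul _)
  exact ((hM.penalty.continuousAt_deriv (abs_nonneg _)).tendsto.comp
    (tendsto_mat_apply hF' i).abs).mul (tendsto_mat_apply hF i).abs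

theorem Assumptions.tendsto_thetaReal (hM : M.Assumptions) {ι : Type*} {l : Filter ι} {x : ι → X}
    {x₀ : X} (hx₀ : x₀ ∈ edom M.h) (hxS : ∀ i, x i ∈ edom M.h) (hx : Tendsto x l (𝓝 x₀)) :
    Tendsto (fun i => M.thetaReal (x i)) l (𝓝 (M.thetaReal x₀)) := by
  have hO := hM.edom_subset hx₀
  have hF := tendsto_lin hM.isOpen_O hM.contDiffOn_F hO hx hx
  have hT := tendsto_lin hM.isOpen_O hM.contDiffOn_T hO hx hx
  simp only [lin_self] at hF hT
  refine ((tendsto_finsetSum _ fun i _ => ?_).add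
    (((hM.continuous_psi.tendsto _).comp hT).const_mul _)).add
    ((hM.tendsto_hreal hx₀ hxS hx).const_mul _)
  exact (hM.penalty.differentiableAt (abs_nonneg _)).continuousAt.tendsto.comp
    (tendsto_mat_apply hF i).abs

end Limits

/-- Convex subgradients are limiting subgradients, with `h = ⊤` off its domain, and testing the
identity against every `d` is the adjoint form of the inclusion. -/
theorem Assumptions.isStationary_of_isMultiplier [FiniteDimensional ℝ X] (hM : M.Assumptions)
    {x : X} (hx : x ∈ edom M.h) {s : Fin m × Fin n → ℝ} {ζ : Mat p q} {g : X}
    (hs : M.IsMultiplier x x s ζ g)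
    (hkkt : ∀ d, ∑ i, deriv M.θ |M.F x i| * s i * (fderiv ℝ M.F x d) i
        + M.ν * inner ℝ ζ (fderiv ℝ M.T x d) + M.lam * inner ℝ g d = 0) : M.IsStationary x := by
  refine ⟨hx, WithLp.toLp 2 s, ζ, g, fun i => ?_, ?_, ?_, ?_⟩
  · refine mem_limitingSubdiff_of_forall_le (EReal.coe_ne_top _) (EReal.coe_ne_bot _) fun y => ?_
    have := hs.abs_le i y
    rw [lin_self] at this
    rw [EReal.toReal_coe, EReal.coe_le_coe_iff]
    simpa [mul_comm] using this
  · refine mem_limitingSubdiff_of_forall_le (EReal.coe_ne_top _) (EReal.coe_ne_bot _) fun y => ?_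
    have := hs.psi_le y
    rw [lin_self] at this
    rwa [EReal.toReal_coe, EReal.coe_le_coe_iff]
  · refine mem_limitingSubdiff_of_forall_le (ne_of_lt hx) (hM.h_ne_bot x) fun y => ?_
    by_cases hy : y ∈ edom M.h
    · rw [hM.h_eq hy, EReal.coe_le_coe_iff]
      exact hs.h_le y hy
    · have : M.h y = ⊤ := by
        by_contra h
        exact hy (lt_top_iff_ne_top.2 h)
      rw [this]; exact le_top
  · refine ext_inner_right ℝ fun d => ?_
    rw [inner_zero_left, ← hkkt d, inner_add_left, inner_add_left, inner_smul_left,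
      inner_smul_left, LinearMap.adjoint_inner_left, LinearMap.adjoint_inner_left, inner_mat]
    rfl

/-! ### Cluster points and potential estimates. -/

namespace Run

variable (R : M.Run)

/-- First-order optimality at a cluster point of the iterates. -/
theorem exists_isMultiplier_of_tendsto [FiniteDimensional ℝ X] (hM : M.Assumptions) {Γ : ℝ}
    (hΓ : ∀ k, ∀ j ≤ R.jlast k, R.γ k j ≤ Γ) {φ : ℕ → ℕ} {x₀ : X} (hx₀ : x₀ ∈ edom M.h)
    (hx : Tendsto (fun i => R.x (φ i)) atTop (𝓝 x₀))
    (hxb : Tendsto (fun i => R.xopt (φ i) (R.jlast (φ i))) atTop (𝓝 x₀)) :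
    ∃ s ζ g, M.IsMultiplier x₀ x₀ s ζ g ∧
      ∀ d, ∑ i, deriv M.θ |M.F x₀ i| * s i * (fderiv ℝ M.F x₀ d) i
        + M.ν * inner ℝ ζ (fderiv ℝ M.T x₀ d) + M.lam * inner ℝ g d + inner ℝ (0 : X) d = 0 := by
  have hO := hM.edom_subset hx₀
  refine hM.exists_isMultiplier hx₀ fun y hy => ?_
  -- The operators of the run need not converge, so their quadratic is dropped at the minimizer and
  -- bounded by `rho * Γ` at the competitor. In the limit `x₀` minimizes the convex part plus this
  -- fixed quadratic centred at `x₀`, whose gradient vanishes there.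
  set Q : X →ₗ[ℝ] X := (R.rho * Γ) • LinearMap.id with hQ
  have hQs : Q.IsSymmetric := fun u v => by simp [hQ, inner_smul_left, inner_smul_right]
  have h := le_add_inner_of_isMinOn (hM.convexOn_convexPart x₀) hQs (z := x₀) hx₀ ?_ hy
  · simpa using h
  intro y hy
  have h1 := hM.tendsto_convexPart hO hx₀ (fun i => R.xopt_mem hM (le_refl (R.jlast (φ i))))
    hxb hx
  have h2 := hM.tendsto_convexPart (l := atTop) (x := fun _ : ℕ => y) hO hy (fun _ => hy)
    tendsto_const_nhds hx
  have h3 : Tendsto (fun i => R.rho * Γ / 2 * ‖y - R.x (φ i)‖ ^ 2) atTop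
      (𝓝 (R.rho * Γ / 2 * ‖y - x₀‖ ^ 2)) := ((hx.const_sub y).norm.pow 2).const_mul _
  have h4 := le_of_tendsto_of_tendsto' h1 (h2.add h3) fun i => by
    have h5 := R.subReal_xopt_le hM (le_refl (R.jlast (φ i))) hy
    have h6 := R.Q_lower (φ i) _ (le_refl (R.jlast (φ i)))
      (R.xopt (φ i) (R.jlast (φ i)) - R.x (φ i))
    have h7 := R.Q_upper (φ i) _ (le_refl (R.jlast (φ i))) (y - R.x (φ i))
    have h8 : 0 ≤ R.γ (φ i) (R.jlast (φ i)) * ‖R.xopt (φ i) (R.jlast (φ i)) - R.x (φ i)‖ ^ 2 :=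
      mul_nonneg (R.γlow_pos.le.trans (R.γlow_le le_rfl)) (sq_nonneg _)
    have h9 : R.rho * R.γ (φ i) (R.jlast (φ i)) * ‖y - R.x (φ i)‖ ^ 2 ≤
        R.rho * Γ * ‖y - R.x (φ i)‖ ^ 2 := by
      have := R.one_lt_rho
      gcongr
      exact hΓ _ _ le_rfl
    rw [subReal, subReal] at h5
    linarith
  have h5 : inner ℝ (y - x₀) (Q (y - x₀)) = R.rho * Γ * ‖y - x₀‖ ^ 2 := by
    simp [hQ, inner_smul_right]
  rw [h5, sub_self, inner_zero_left]
  linarith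

/-- Estimates, in terms of the model decrease, for the potential and its subdifferential at the
exact solutions of the subproblems. -/
theorem exists_potential_estimates [FiniteDimensional ℝ X] (hM : M.Assumptions) {K : Set X}
    {B Γ c : ℝ} (hc : 0 ≤ c) (hB : M.LocalBounds K B) (hKS : K ⊆ edom M.h)
    (hK : ∀ k, R.x k ∈ K ∧ ∀ j ≤ R.jlast k, R.xin k j ∈ K ∧ R.xopt k j ∈ K) (hΓ0 : 0 ≤ Γ)
    (hΓ : ∀ k, ∀ j ≤ R.jlast k, R.γ k j ≤ Γ) :
    ∃ C : ℝ, 0 < C ∧ ∀ k,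
      ‖R.x (k + 1) - R.x k‖ ≤ C * √(R.decrease k (R.jlast k)) ∧
      ‖R.xopt k (R.jlast k) - R.x k‖ ≤ C * √(R.decrease k (R.jlast k)) ∧
      ∃ t : ℝ, |t| ≤ C * √(R.decrease k (R.jlast k)) ∧
        (∃ r : ℝ, M.Xi c (WithLp.toLp 2 (R.xopt k (R.jlast k), WithLp.toLp 2 (R.x k, t))) = r ∧
          M.thetaReal (R.x k) ≤ r ∧
          r ≤ M.thetaReal (R.x k) + C * R.decrease k (R.jlast k)) ∧
        ∃ v ∈ limitingSubdiff (M.Xi c)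
          (WithLp.toLp 2 (R.xopt k (R.jlast k), WithLp.toLp 2 (R.x k, t))),
          ‖v‖ ≤ C * √(R.decrease k (R.jlast k)) := by
  have hμ := R.μup_pos
  have hγ := R.γlow_pos
  have hρ := R.one_lt_rho
  have hν := hM.nu_nonneg
  have hB0 := hB.nonneg
  set A : ℝ := 4 * (1 + R.μup) / R.γlow with hA
  have hA0 : 0 ≤ A := by positivity
  set C₁ : ℝ := (m * n : ℕ) * (B * B) with hC₁
  have hC₁0 : 0 ≤ C₁ := by positivity
  -- `E * D` exactly covers the possible shortfall of the potential below `Θ`: the model decrease,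
  -- the inexactness gap, the proximal term, and the error of `le_smoothXi`. Choosing `t = √E * √D`
  -- adds that amount.
  set E : ℝ := 1 + R.μup / 2 + R.rho * Γ / 2 * A + C₁ * A with hE
  have hE0 : 0 ≤ E := by positivity
  -- The coefficient of `‖xb - R.x k‖` in the subgradient bound; its last summand comes from the
  -- proximal residual `Q (xb - R.x k)`.
  set C₂ : ℝ := 2 * C₁ + M.ν * (B * B) + 2 * c + R.rho * Γ with hC₂
  have hC₂0 : 0 ≤ C₂ := by positivity
  have i1 : 0 ≤ c / 2 * A := by positivity
  have i2 : 0 ≤ C₂ * √A := by positivity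
  have i3 := Real.sqrt_nonneg A
  have i4 := Real.sqrt_nonneg E
  refine ⟨1 + √A + 2 * √E + (c / 2 * A + E) + C₂ * √A, by positivity, fun k => ?_⟩
  set C : ℝ := 1 + √A + 2 * √E + (c / 2 * A + E) + C₂ * √A with hC
  set D := R.decrease k (R.jlast k) with hD
  have hD0 : 0 < D := R.decrease_pos hM le_rfl
  set xb := R.xopt k (R.jlast k) with hxb
  set Q := R.Q k (R.jlast k) with hQ
  have hsD := Real.sqrt_nonneg D
  have hsq : √D ^ 2 = D := Real.sq_sqrt hD0.le
  have n1 : ‖R.x (k + 1) - R.x k‖ ≤ √A * √D := by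
    rw [← Real.sqrt_mul hA0]
    refine Real.le_sqrt_of_sq_le ?_
    rw [hA, div_mul_eq_mul_div, le_div_iff₀ hγ, R.x_succ]
    linarith [R.norm_xin_sub_sq_le hM (le_refl (R.jlast k))]
  have n2' : ‖xb - R.x k‖ ^ 2 ≤ A * D := by
    rw [hA, div_mul_eq_mul_div, le_div_iff₀ hγ]
    have h1 := R.norm_xopt_sub_sq_le hM (le_refl (R.jlast k))
    nlinarith
  have n2 : ‖xb - R.x k‖ ≤ √A * √D := by
    rw [← Real.sqrt_mul hA0]
    exact Real.le_sqrt_of_sq_le n2'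
  have hxbK : xb ∈ K := ((hK k).2 _ le_rfl).2
  have hxK : R.x k ∈ K := (hK k).1
  have hQup : ∀ d, inner ℝ d (Q d) ≤ R.rho * Γ * ‖d‖ ^ 2 := fun d =>
    (R.Q_upper k _ le_rfl d).trans (by gcongr; exact hΓ k _ le_rfl)
  have hQlow : ∀ d, 0 ≤ inner ℝ d (Q d) := fun d =>
    (mul_nonneg (hγ.le.trans (R.γlow_le le_rfl)) (sq_nonneg _)).trans (R.Q_lower k _ le_rfl d)
  refine ⟨n1.trans (by gcongr; linarith), n2.trans (by gcongr; linarith), √E * √D, ?_, ?_, ?_⟩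
  · rw [abs_of_nonneg (by positivity)]
    gcongr; linarith
  · refine ⟨_, hM.Xi_eq c (hKS hxbK) (hM.edom_subset (hKS hxK)), ?_, ?_⟩
    · have h1 := hB.le_smoothXi hM hc hxbK hxK (√E * √D)
      rw [mul_pow, Real.sq_sqrt hE0, hsq] at h1
      have h2 := R.subReal_gap hM (le_refl (R.jlast k))
      have h3 := hQup (xb - R.x k)
      have h4 : R.rho * Γ * ‖xb - R.x k‖ ^ 2 ≤ R.rho * Γ * (A * D) := by gcongr
      have h5 : C₁ * ‖xb - R.x k‖ ^ 2 ≤ C₁ * (A * D) := by gcongr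
      have h6 : E * D = D + R.μup / 2 * D + R.rho * Γ / 2 * (A * D) + C₁ * (A * D) := by
        rw [hE]; ring
      have h7 : M.subReal (R.x k) Q xb = M.convexPart (R.x k) xb +
        (1 / 2) * inner ℝ (xb - R.x k) (Q (xb - R.x k)) + M.subConst (R.x k) := rfl
      have h8 : D = M.thetaReal (R.x k) - M.subReal (R.x k) Q (R.xin k (R.jlast k)) := rfl
      rw [← h8] at h2
      change _ ≤ M.smoothXi c (xb, R.x k, √E * √D) + M.lam * M.hreal xb
      linarith
    · have h1 := hM.smoothXi_le c xb (R.x k) (√E * √D)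
      rw [mul_pow, Real.sq_sqrt hE0, hsq] at h1
      have h2 := R.subReal_xopt_le hM (le_refl (R.jlast k)) (R.x_mem hM k)
      rw [subReal_self] at h2
      have h7 : M.subReal (R.x k) Q xb = M.convexPart (R.x k) xb +
        (1 / 2) * inner ℝ (xb - R.x k) (Q (xb - R.x k)) + M.subConst (R.x k) := rfl
      have h3 := hQlow (xb - R.x k)
      have h4 : c / 2 * ‖xb - R.x k‖ ^ 2 ≤ c / 2 * (A * D) := by gcongr
      have h5 : (c / 2 * A + E) * D ≤ C * D := by gcongr; linarith
      change M.smoothXi c (xb, R.x k, √E * √D) + M.lam * M.hreal xb ≤ _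
      linarith
  · have hmin : ∀ y ∈ edom M.h, M.convexPart (R.x k) xb ≤
        M.convexPart (R.x k) y + inner ℝ (Q (xb - R.x k)) (y - xb) := fun y hy =>
      le_add_inner_of_isMinOn (hM.convexOn_convexPart (R.x k)) (R.Q_symm k _ le_rfl)
        (hKS hxbK) (fun y hy => by
          have := R.subReal_xopt_le hM (le_refl (R.jlast k)) hy
          rw [subReal, subReal] at this
          linarith) hy
    obtain ⟨s, ζ, g, hs, hkkt⟩ := hM.exists_isMultiplier (hKS hxbK) hmin
    obtain ⟨v, hv, hvn⟩ :=
      hB.exists_mem_limitingSubdiff_Xi hM hKS hc hxbK hxK hs hkkt (√E * √D)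
    refine ⟨v, hv, hvn.trans ?_⟩
    have h1 := norm_apply_le_of_inner_le (R.Q_symm k _ le_rfl) hQlow hQup (xb - R.x k)
    rw [abs_of_nonneg (by positivity)]
    have h2 : C₂ * ‖xb - R.x k‖ ≤ C₂ * (√A * √D) := by gcongr
    have h3 : (C₂ * √A + 2 * √E) * √D ≤ C * √D := by gcongr; linarith
    have h4 : C₂ * ‖xb - R.x k‖ = (2 * C₁ + M.ν * (B * B) + 2 * c) * ‖xb - R.x k‖ +
        R.rho * Γ * ‖xb - R.x k‖ := by rw [hC₂]; ring
    linarith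

end Run

end Model

/-- The Kurdyka–Łojasiewicz inequality in real terms, for a single subgradient. -/
theorem HasKLPropertyAt.exists_real {E : Type*} [NormedAddCommGroup E] [InnerProductSpace ℝ E]
    {f : E → EReal} {x₀ : E} {r₀ : ℝ} (h : HasKLPropertyAt f x₀) (hr₀ : f x₀ = r₀) :
    ∃ (η : ℝ) (φ : ℝ → ℝ), 0 < η ∧ ContinuousWithinAt φ (Set.Ici 0) 0 ∧ φ 0 = 0 ∧
      (∀ s, 0 ≤ s → s < η → 0 ≤ φ s) ∧
      ∀ᶠ x in 𝓝 x₀, ∀ (r : ℝ) (v : E), f x = r → v ∈ limitingSubdiff f x → r < r₀ + η →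
        ∀ a b : ℝ, r₀ ≤ b → b < a → a ≤ r → a - b ≤ ‖v‖ * (φ (a - r₀) - φ (b - r₀)) := by
  obtain ⟨η', φ, hη', hφ, hev⟩ := h
  -- Shrinking to a finite `η` moves all later estimates into the reals.
  obtain ⟨η, hη, hηη'⟩ := EReal.lt_iff_exists_real_btwn.1 hη'
  have hη0 : 0 < η := by exact_mod_cast hη
  have hlt : ∀ s : ℝ, s < η → (s : EReal) < η' := fun s hs =>
    (EReal.coe_lt_coe_iff.2 hs).trans hηη'
  refine ⟨η, φ, hη0, ?_, hφ.map_zero, fun s h0 h1 => hφ.nonneg s h0 (hlt s h1), ?_⟩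
  · have h1 := hφ.continuousOn 0 ⟨le_rfl, hlt 0 hη0⟩
    refine h1.mono_of_mem_nhdsWithin ?_
    filter_upwards [self_mem_nhdsWithin, nhdsWithin_le_nhds (Iio_mem_nhds hη0)] with s h0 h2
    exact ⟨h0, hlt s h2⟩
  · filter_upwards [hev] with x hx r v hr hv hrη a b hb hba har
    have h1 : f x₀ < f x := by
      rw [hr₀, hr, EReal.coe_lt_coe_iff]; linarith
    have h2 : f x < f x₀ + η' := by
      rw [hr₀, hr]
      refine lt_of_lt_of_le (EReal.coe_lt_coe_iff.2 hrη) ?_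
      rw [EReal.coe_add]
      gcongr
    have h3 := hx h1 h2
    rw [hr, hr₀, ← EReal.coe_sub, EReal.toReal_coe] at h3
    have h4 : Metric.infEDist (0 : E) (limitingSubdiff f x) ≤ ENNReal.ofReal ‖v‖ := by
      refine (Metric.infEDist_le_edist_of_mem hv).trans ?_
      rw [edist_dist, dist_zero_left]
    have h5 : (1 : ENNReal) ≤ ENNReal.ofReal (deriv φ (r - r₀)) * ENNReal.ofReal ‖v‖ :=
      h3.trans (by gcongr)
    have hpos : 0 < deriv φ (r - r₀) := hφ.deriv_pos _ (by linarith) (hlt _ (by linarith))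
    rw [← ENNReal.ofReal_mul hpos.le, ENNReal.one_le_ofReal] at h5
    have h6 := concaveOn_deriv_mul_sub_le hφ.concaveOn (a := a - r₀) (b := b - r₀) (c := r - r₀)
      ⟨by linarith, hlt _ (by linarith)⟩ ⟨by linarith, hlt _ (by linarith)⟩
      ⟨by linarith, hlt _ (by linarith)⟩ (by linarith) (by linarith)
      (hφ.differentiableAt _ (by linarith) (hlt _ (by linarith)))
    have e1 : a - r₀ - (b - r₀) = a - b := by ring
    rw [e1] at h6
    calc a - b ≤ deriv φ (r - r₀) * ‖v‖ * (a - b) := le_mul_of_one_le_left (by linarith) h5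
      _ = ‖v‖ * (deriv φ (r - r₀) * (a - b)) := by ring
      _ ≤ _ := by gcongr

end IPMM

/-! ### Finite length and convergence. -/

open IPMM IPMM.Model in
theorem mainTheorem1 {X : Type*} [NormedAddCommGroup X] [InnerProductSpace ℝ X]
    [FiniteDimensional ℝ X] {m n p q : ℕ} (M : IPMM.Model X m n p q) (hM : M.Assumptions)
    (R : M.Run) (hbdd : Bornology.IsBounded (Set.range R.x))
    (γhat : ℝ) (hγhat : 0 < γhat) (hKL : IPMM.IsKLFunction (M.Xi γhat)) :
    Summable (fun k : ℕ => ‖R.x (k + 1) - R.x k‖) ∧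
      ∃ xstar : X, Filter.Tendsto R.x Filter.atTop (nhds xstar) ∧ M.IsStationary xstar := by
  obtain ⟨K, hKc, hKconv, hKS, hK⟩ := R.exists_compact hM hbdd
  obtain ⟨B, hB⟩ := hM.exists_localBounds hKc hKconv (hKS.trans hM.edom_subset)
  obtain ⟨Γ, hΓ0, hΓ⟩ := R.exists_γ_le hM hB hK
  obtain ⟨C, hC, hest⟩ := R.exists_potential_estimates hM hγhat.le hB hKS hK hΓ0 hΓ
  choose hstep hxb t ht hval v hv hvn using hest
  choose r hr hr1 hr2 using hval
  obtain ⟨x₀, hx₀K, φ, hφ, hφx⟩ := hKc.tendsto_subseq fun k => (hK k).1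
  have hx₀ := hKS hx₀K
  set D : ℕ → ℝ := fun k => R.decrease k (R.jlast k) with hD
  set θ₀ := M.thetaReal x₀ with hθ₀
  have hlim : Tendsto (fun k => M.thetaReal (R.x k)) atTop (𝓝 θ₀) :=
    (tendsto_iff_tendsto_subseq_of_antitone (R.thetaReal_antitone hM) hφ.tendsto_atTop).2
      (hM.tendsto_thetaReal hx₀ (fun i => R.x_mem hM (φ i)) hφx)
  have hdec : ∀ k, D k ≤ M.thetaReal (R.x k) - M.thetaReal (R.x (k + 1)) := R.decrease_le hM
  have hDpos : ∀ k, 0 < D k := fun k => R.decrease_pos hM le_rfl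
  have hge : ∀ k, θ₀ ≤ M.thetaReal (R.x k) := fun k => (R.thetaReal_antitone hM).le_of_tendsto hlim k
  have hD0 : Tendsto D atTop (𝓝 0) := by
    refine squeeze_zero (fun k => (hDpos k).le) hdec ?_
    simpa using hlim.sub (hlim.comp (tendsto_add_atTop_nat 1))
  have hsD0 : Tendsto (fun k => C * √(D k)) atTop (𝓝 0) := by
    have := ((Real.continuous_sqrt.tendsto 0).comp hD0).const_mul C
    simpa using this
  have hr0 : Tendsto r atTop (𝓝 θ₀) := by
    refine tendsto_of_tendsto_of_tendsto_of_le_of_le hlim ?_ hr1 hr2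
    simpa using hlim.add (hD0.const_mul C)
  have hxb0 : Tendsto (fun k => R.xopt k (R.jlast k) - R.x k) atTop (𝓝 0) :=
    squeeze_zero_norm hxb hsD0
  have ht0 : Tendsto t atTop (𝓝 0) := squeeze_zero_norm ht hsD0
  have hxbx : Tendsto (fun i => R.xopt (φ i) (R.jlast (φ i))) atTop (𝓝 x₀) := by
    simpa using (hxb0.comp hφ.tendsto_atTop).add hφx
  obtain ⟨s, ζ, g, hs, hkkt⟩ := R.exists_isMultiplier_of_tendsto hM hΓ hx₀ hφx hxbx
  set w₀ : WithLp 2 (X × WithLp 2 (X × ℝ)) := WithLp.toLp 2 (x₀, WithLp.toLp 2 (x₀, 0)) with hw₀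
  have hXi₀ : M.Xi γhat w₀ = θ₀ := by
    rw [hM.Xi_eq γhat (w := w₀) hx₀ (hM.edom_subset hx₀), EReal.coe_eq_coe_iff]
    simp [hw₀, smoothXi, lin_self, hθ₀, thetaReal]
  -- Optimality at the cluster point puts `w₀` in the domain of the limiting subdifferential, as
  -- required before the KL property can be invoked.
  obtain ⟨v₀, hv₀, -⟩ :=
    hB.exists_mem_limitingSubdiff_Xi hM hKS hγhat.le hx₀K hx₀K hs hkkt 0
  obtain ⟨η, ϕ, hη, hϕc, hϕ0, hϕnn, hϕ⟩ := (hKL w₀ ⟨v₀, hv₀⟩).exists_real hXi₀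
  have hcont : Tendsto (fun w : X × X × ℝ => (WithLp.toLp 2 (w.1, WithLp.toLp 2 w.2) :
      WithLp 2 (X × WithLp 2 (X × ℝ)))) (𝓝 (x₀, x₀, 0)) (𝓝 w₀) := by
    refine Continuous.tendsto (f := fun w : X × X × ℝ => (WithLp.toLp 2 (w.1, WithLp.toLp 2 w.2) :
      WithLp 2 (X × WithLp 2 (X × ℝ)))) ?_ (x₀, x₀, 0)
    fun_prop
  obtain ⟨δ, hδ, hball⟩ := Metric.eventually_nhds_iff.1 (hcont.eventually hϕ)
  have hrlim : Tendsto (fun k => M.thetaReal (R.x k) - θ₀) atTop (𝓝[≥] 0) :=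
    tendsto_nhdsWithin_iff.2 ⟨by simpa using hlim.sub_const θ₀,
      Eventually.of_forall fun k => sub_nonneg.2 (hge k)⟩
  have hsum : Summable fun k => √(D k) := by
    -- The radius is halved because the KL neighbourhood must contain the exact minimizer too, which
    -- is eventually within `δ / 2` of the iterate.
    refine summable_of_local_decrease (x := R.x) (p := x₀) (C := C) (δ := δ / 2)
      (P := fun k => C * ϕ (M.thetaReal (R.x k) - θ₀)) hC.le (half_pos hδ)
      (fun k => Real.sqrt_nonneg _) (fun k => by rw [dist_eq_norm]; exact hstep k) ?_ ?_ ?_ ?_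
    · have h1 := (tendsto_nhdsWithin_iff.1 hrlim).1.eventually_lt_const hη
      filter_upwards [h1] with k hk
      exact mul_nonneg hC.le (hϕnn _ (sub_nonneg.2 (hge k)) hk)
    · have := (hϕc.tendsto.comp hrlim).const_mul C
      rwa [hϕ0, mul_zero] at this
    · exact (hφx.mapClusterPt).of_comp hφ.tendsto_atTop
    · have h1 := hr0.eventually_lt_const (by linarith : θ₀ < θ₀ + η)
      have h2 := (tendsto_zero_iff_norm_tendsto_zero.1 hxb0).eventually_lt_const (half_pos hδ)
      have h3 := (tendsto_zero_iff_norm_tendsto_zero.1 ht0).eventually_lt_const hδ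
      filter_upwards [h1, h2, h3] with k hk1 hk2 hk3 hk4
      have hclose : dist ((R.xopt k (R.jlast k), R.x k, t k) : X × X × ℝ) (x₀, x₀, 0) < δ := by
        simp only [Prod.dist_eq, max_lt_iff]
        refine ⟨?_, by linarith, by rwa [dist_zero_right]⟩
        calc dist (R.xopt k (R.jlast k)) x₀ ≤
              dist (R.xopt k (R.jlast k)) (R.x k) + dist (R.x k) x₀ := dist_triangle _ _ _
          _ < δ / 2 + δ / 2 := add_lt_add (by rwa [dist_eq_norm]) hk4
          _ = δ := add_halves δ
      -- The subgradient is taken at the potential value `r k`, while the increment of `ϕ` is taken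
      -- between consecutive objective values. Positivity of `D k` then forces `Δ ≥ 0` and allows
      -- cancelling one factor `√(D k)`.
      have h5 := hball hclose (r k) (v k) (hr k) (hv k) hk1 (M.thetaReal (R.x k))
        (M.thetaReal (R.x (k + 1))) (hge _) (by linarith [hdec k, hDpos k]) (hr1 k)
      have h6 : 0 < √(D k) := Real.sqrt_pos.2 (hDpos k)
      have h7 : √(D k) * √(D k) = D k := Real.mul_self_sqrt (hDpos k).le
      set Δ := ϕ (M.thetaReal (R.x k) - θ₀) - ϕ (M.thetaReal (R.x (k + 1)) - θ₀) with hΔ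
      have h8 : √(D k) * √(D k) ≤ ‖v k‖ * Δ := by rw [h7]; exact (hdec k).trans h5
      have h9 : 0 ≤ Δ := by
        by_contra hneg
        push Not at hneg
        nlinarith [norm_nonneg (v k), mul_pos h6 h6]
      have h10 : ‖v k‖ * Δ ≤ C * √(D k) * Δ := mul_le_mul_of_nonneg_right (hvn k) h9
      have h11 : √(D k) * √(D k) ≤ √(D k) * (C * Δ) := by linarith
      have h12 := le_of_mul_le_mul_left h11 h6
      rw [hΔ, mul_sub] at h12
      exact h12
  have hsum' : Summable (fun k : ℕ => ‖R.x (k + 1) - R.x k‖) :=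
    Summable.of_nonneg_of_le (fun k => norm_nonneg _) hstep (hsum.mul_left C)
  refine ⟨hsum', x₀, ?_, hM.isStationary_of_isMultiplier hx₀ hs fun d => by simpa using hkkt d⟩
  have hcauchy : CauchySeq R.x := cauchySeq_of_summable_dist (by
    simpa only [dist_comm, dist_eq_norm, Nat.succ_eq_add_one, norm_sub_rev] using hsum')
  exact tendsto_nhds_of_cauchySeq_of_subseq hcauchy hφ.tendsto_atTop hφx
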